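/- **Conventions.** $B(x,r)\subset\mathbb R^n$ is the open ball of radius $r$ centred at $x$, $|\cdot|$ is Lebesgue measure, and $0\cdot\infty=0$. A Young function is a convex, left-continuous $\Phi:[0,\infty)\to[0,\infty]$ with $\lim_{r\to0+}\Phi(r)=\Phi(0)=0$ and $\lim_{r\to\infty}\Phi(r)=\infty$. Put $\Phi^{-1}(s)=\inf\{r\ge0:\Phi(r)>s\}$. We write $\Phi\in\Delta'$ if, for some $C>1$, $\Phi(tr)\le C\,\Phi(t)\Phi(r)$ for all $t,r\ge0$. Let $$\|f\|_{L^\Phi}=\inf\Big\{\lambda>0:\int_{\mathbb R^n}\Phi\Big(\frac{|f(x)|}{\lambda}\Big)dx\le1\Big\},\qquad \|f\|_{WL^\Phi}=\inf\Big\{\lambda>0:\sup_{t>0}\Phi\Big(\frac t\lambda\Big)\,|\{|f|>t\}|\le1\Big\}.$$ The space $L^\Phi(\mathbb R^n)$ consists of the $f\in L^1_{\rm loc}(\mathbb R^n)$ with $\int\Phi(k|f|)<\infty$ for some $k>0$, and $WL^\Phi(\mathbb R^n)$ of the $f\in L^1_{\rm loc}(\mathbb R^n)$ with $\|f\|_{WL^\Phi}<\infty$;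 $f$ lies in $L^\Phi_{\rm loc}$ (resp. $WL^\Phi_{\rm loc}$) if $f\chi_B\in L^\Phi$ (resp. $WL^\Phi$) for every ball $B$. For a positive measurable $\varphi$ on $\mathbb R^n\times(0,\infty)$, $\mathcal M^{\Phi,\varphi}(\mathbb R^n)$ is the set of $f\in L^\Phi_{\rm loc}$ with $$\|f\|_{\mathcal M^{\Phi,\varphi}}=\sup_{x\in\mathbb R^n,\,r>0}\varphi(x,r)^{-1}\,\Phi^{-1}(|B(x,r)|^{-1})\,\|f\chi_{B(x,r)}\|_{L^\Phi}<\infty ,$$ and $W\mathcal M^{\Phi,\varphi}(\mathbb R^n)$ is defined in the same way with $WL^\Phi_{\rm loc}$ and $\|\cdot\|_{WL^\Phi}$ in place of $L^\Phi_{\rm loc}$ and $\|\cdot\|_{L^\Phi}$. A function $\varphi$ on $(0,\infty)$ is regarded as the function $(x,r)\mapsto\varphi(r)$. We write $\varphi\in\Omega_\Phi$ if $\varphi$ is positive and measurable on $\mathbb R^n\times(0,\infty)$ and, for all $t>0$, $$\sup_{x}\Big\|\frac{\Phi^{-1}(|B(x,r)|^{-1})}{\varphi(x,r)}\Big\|_{L^\infty_r(t,\infty)}<\infty,\qquad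 \sup_x\big\|\varphi(x,r)^{-1}\big\|_{L^\infty_r(0,t)}<\infty .$$ We write $\varphi\in\mathcal G_\Phi$ if $\varphi:(0,\infty)\to(0,\infty)$ is almost decreasing and $t\mapsto\varphi(t)/\Phi^{-1}(t^{-n})$ is almost increasing; here $\psi$ is almost increasing (resp. almost decreasing) if there is $C>0$ with $\psi(r)\le C\psi(s)$ (resp. $\psi(r)\ge C\psi(s)$) whenever $0<r\le s$. Finally, let $$M_\alpha f(x)=\sup_{t>0}|B(x,t)|^{-1+\frac\alpha n}\int_{B(x,t)}|f(y)|\,dy .$$ Boundedness of $M_\alpha$ from $\mathcal M^{\Phi,\varphi}$ to $W\mathcal M^{\Psi,\eta}$ means that there is $C$ such that $M_\alpha f\in W\mathcal M^{\Psi,\eta}$ and $\|M_\alpha f\|_{W\mathcal M^{\Psi,\eta}}\le C\|f\|_{\mathcal M^{\Phi,\varphi}}$ for all $f\in\mathcal M^{\Phi,\varphi}$. **Theorem.** Let $0<\alpha<n$, let $\Phi\in\Delta'$ be a Young function, let $\varphi:(0,\infty)\to(0,\infty)$ belong to $\Omega_\Phi$, let $\beta\in(0,1)$, and put $\eta(t)=\varphi(t)^\beta$,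 $\Psi(t)=\Phi(t^{1/\beta})$. 1. If there is $C$ such that, for all $x\in\mathbb R^n$ and $r>0$, $$\sup_{r<t<\infty}\Phi^{-1}\big(|B(x,t)|^{-1}\big)\operatorname*{ess\,inf}_{t<s<\infty}\frac{\varphi(s)}{\Phi^{-1}\big(|B(x,s)|^{-1}\big)}\le C\,\varphi(r),$$ then the condition $$t^\alpha\varphi(t)+\sup_{t<r<\infty}r^\alpha\varphi(r)\le C\,\varphi(t)^\beta\quad\text{for all }t>0,$$ with $C>0$ independent of $t$, is sufficient for the boundedness of $M_\alpha$ from $\mathcal M^{\Phi,\varphi}(\mathbb R^n)$ to $W\mathcal M^{\Psi,\eta}(\mathbb R^n)$. 2. If $\varphi\in\mathcal G_\Phi$, then the condition $$t^\alpha\varphi(t)\le C\,\varphi(t)^\beta\quad\text{for all }t>0,\qquad(\ast)$$ with $C>0$ independent of $t$, is necessary for the boundedness of $M_\alpha$ from $\mathcal M^{\Phi,\varphi}(\mathbb R^n)$ to $W\mathcal M^{\Psi,\eta}(\mathbb R^n)$. 3. If $\varphi\in\mathcal G_\Phi$, then $(\ast)$ is necessary and sufficient for the boundedness of $M_\alpha$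 from $\mathcal M^{\Phi,\varphi}(\mathbb R^n)$ to $W\mathcal M^{\Psi,\eta}(\mathbb R^n)$. -/

import Mathlib

open MeasureTheory Set Filter Topology
open scoped NNReal ENNReal

noncomputable section

namespace OrliczMorrey

/-- Young functions `Φ : [0,∞) → [0,∞]`: convex, left-continuous,
`lim_{r → 0+} Φ r = Φ 0 = 0` and `lim_{r → ∞} Φ r = ∞`. -/
structure IsYoung (Φ : ℝ≥0 → ℝ≥0∞) : Prop where
  convex : ConvexOn ℝ≥0 univ Φ
  leftCont : ∀ r, ContinuousWithinAt Φ (Iic r) r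
  zero : Φ 0 = 0
  tendsto_zero : Tendsto Φ (𝓝[>] 0) (𝓝 0)
  tendsto_top : Tendsto Φ atTop (𝓝 ⊤)

/-- The `Δ'`-condition. -/
def DeltaPrime (Φ : ℝ≥0 → ℝ≥0∞) : Prop :=
  ∃ C : ℝ≥0, 1 < C ∧ ∀ t r : ℝ≥0, Φ (t * r) ≤ C * Φ t * Φ r

/-- The generalized inverse `Φ⁻¹(s) = inf {r ≥ 0 : Φ r > s}`, `0 ≤ s ≤ ∞`, with `inf ∅ = ∞`. -/
def youngInv (Φ : ℝ≥0 → ℝ≥0∞) (s : ℝ≥0∞) : ℝ≥0∞ :=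
  ⨅ (r : ℝ≥0) (_ : s < Φ r), (r : ℝ≥0∞)

variable {n : ℕ}

/-- The quantity `Φ⁻¹(|B(x,r)|⁻¹)`. -/
def ballInv (Φ : ℝ≥0 → ℝ≥0∞) (x : EuclideanSpace ℝ (Fin n)) (r : ℝ) : ℝ≥0∞ :=
  youngInv Φ (volume (Metric.ball x r))⁻¹

/-- The Luxemburg norm `‖f‖_{L^Φ}` (equal to `∞` if no `lam` is admissible). -/
def orliczNorm (Φ : ℝ≥0 → ℝ≥0∞) (f : EuclideanSpace ℝ (Fin n) → ℝ) : ℝ≥0∞ :=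
  ⨅ (lam : ℝ≥0) (_ : 0 < lam) (_ : ∫⁻ x, Φ (‖f x‖₊ / lam) ≤ 1), (lam : ℝ≥0∞)

/-- Membership in the Orlicz space `L^Φ(ℝⁿ)`. -/
def MemOrlicz (Φ : ℝ≥0 → ℝ≥0∞) (f : EuclideanSpace ℝ (Fin n) → ℝ) : Prop :=
  LocallyIntegrable f ∧ ∃ k : ℝ≥0, 0 < k ∧ ∫⁻ x, Φ (k * ‖f x‖₊) < ∞

/-- Membership in `L^Φ_loc(ℝⁿ)`: `f χ_B ∈ L^Φ` for all balls `B`. -/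
def MemOrliczLoc (Φ : ℝ≥0 → ℝ≥0∞) (f : EuclideanSpace ℝ (Fin n) → ℝ) : Prop :=
  ∀ (x : EuclideanSpace ℝ (Fin n)) (r : ℝ), 0 < r → MemOrlicz Φ ((Metric.ball x r).indicator f)

/-- The norm of the generalized Orlicz–Morrey space `M^{Φ,φ}`. -/
def morreyNorm (Φ : ℝ≥0 → ℝ≥0∞) (φ : EuclideanSpace ℝ (Fin n) → ℝ → ℝ)
    (f : EuclideanSpace ℝ (Fin n) → ℝ) : ℝ≥0∞ :=
  ⨆ (x : EuclideanSpace ℝ (Fin n)) (r : ℝ) (_ : 0 < r),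
    (ENNReal.ofReal (φ x r))⁻¹ * ballInv Φ x r * orliczNorm Φ ((Metric.ball x r).indicator f)

/-- Membership in `M^{Φ,φ}(ℝⁿ)`. -/
def MemMorrey (Φ : ℝ≥0 → ℝ≥0∞) (φ : EuclideanSpace ℝ (Fin n) → ℝ → ℝ)
    (f : EuclideanSpace ℝ (Fin n) → ℝ) : Prop :=
  MemOrliczLoc Φ f ∧ morreyNorm Φ φ f < ∞

/- The weak spaces are defined for functions with values in `[0,∞]`, so that the possible value
`∞` of a maximal function is not discarded. -/

/-- The distribution function `d_g(t) = |{x : g x > t}|` of `g ≥ 0`. -/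
def distrib (g : EuclideanSpace ℝ (Fin n) → ℝ≥0∞) (t : ℝ≥0) : ℝ≥0∞ :=
  volume {x | (t : ℝ≥0∞) < g x}

/-- The weak Orlicz quasinorm `‖g‖_{WL^Φ}`. -/
def weakOrliczNorm (Φ : ℝ≥0 → ℝ≥0∞) (g : EuclideanSpace ℝ (Fin n) → ℝ≥0∞) : ℝ≥0∞ :=
  ⨅ (lam : ℝ≥0) (_ : 0 < lam) (_ : ⨆ (t : ℝ≥0) (_ : 0 < t), Φ (t / lam) * distrib g t ≤ 1),
    (lam : ℝ≥0∞)

/-- Membership in the weak Orlicz space `WL^Φ(ℝⁿ)`. -/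
def MemWeakOrlicz (Φ : ℝ≥0 → ℝ≥0∞) (g : EuclideanSpace ℝ (Fin n) → ℝ≥0∞) : Prop :=
  LocallyIntegrable g ∧ weakOrliczNorm Φ g < ∞

/-- Membership in `WL^Φ_loc(ℝⁿ)`. -/
def MemWeakOrliczLoc (Φ : ℝ≥0 → ℝ≥0∞) (g : EuclideanSpace ℝ (Fin n) → ℝ≥0∞) : Prop :=
  ∀ (x : EuclideanSpace ℝ (Fin n)) (r : ℝ), 0 < r →
    MemWeakOrlicz Φ ((Metric.ball x r).indicator g)

/-- The quasinorm of the weak generalized Orlicz–Morrey space `WM^{Φ,φ}`. -/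
def weakMorreyNorm (Φ : ℝ≥0 → ℝ≥0∞) (φ : EuclideanSpace ℝ (Fin n) → ℝ → ℝ)
    (g : EuclideanSpace ℝ (Fin n) → ℝ≥0∞) : ℝ≥0∞ :=
  ⨆ (x : EuclideanSpace ℝ (Fin n)) (r : ℝ) (_ : 0 < r),
    (ENNReal.ofReal (φ x r))⁻¹ * ballInv Φ x r * weakOrliczNorm Φ ((Metric.ball x r).indicator g)

/-- Membership in `WM^{Φ,φ}(ℝⁿ)`. -/
def MemWeakMorrey (Φ : ℝ≥0 → ℝ≥0∞) (φ : EuclideanSpace ℝ (Fin n) → ℝ → ℝ)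
    (g : EuclideanSpace ℝ (Fin n) → ℝ≥0∞) : Prop :=
  MemWeakOrliczLoc Φ g ∧ weakMorreyNorm Φ φ g < ∞

/-- The fractional maximal function
`M_α f(x) = sup_{t > 0} |B(x,t)|^{-1 + α/n} ∫_{B(x,t)} |f|`. -/
def fracMax (α : ℝ) (f : EuclideanSpace ℝ (Fin n) → ℝ) (x : EuclideanSpace ℝ (Fin n)) : ℝ≥0∞ :=
  ⨆ (t : ℝ) (_ : 0 < t),
    volume (Metric.ball x t) ^ (-1 + α / n) * ∫⁻ y in Metric.ball x t, ‖f y‖ₑ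

/-- `M_α` is bounded from `M^{Φ,φ}(ℝⁿ)` to `WM^{Ψ,η}(ℝⁿ)`. -/
def FracMaxWeakBounded (α : ℝ) (Φ : ℝ≥0 → ℝ≥0∞) (φ : EuclideanSpace ℝ (Fin n) → ℝ → ℝ)
    (Ψ : ℝ≥0 → ℝ≥0∞) (η : EuclideanSpace ℝ (Fin n) → ℝ → ℝ) : Prop :=
  ∃ C : ℝ≥0, ∀ f : EuclideanSpace ℝ (Fin n) → ℝ, MemMorrey Φ φ f →
    MemWeakMorrey Ψ η (fracMax α f) ∧
      weakMorreyNorm Ψ η (fracMax α f) ≤ C * morreyNorm Φ φ f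

/-- The class `Ω_Φ` of positive (Lebesgue) measurable functions `φ` on `ℝⁿ × (0,∞)` such that
for all `t > 0` both
`sup_x ‖Φ⁻¹(|B(x,r)|⁻¹) / φ(x,r)‖_{L^∞(t,∞)}` and `sup_x ‖1 / φ(x,r)‖_{L^∞(0,t)}` are finite
(norms in the variable `r`). -/
structure MemOmega (Φ : ℝ≥0 → ℝ≥0∞) (φ : EuclideanSpace ℝ (Fin n) → ℝ → ℝ) : Prop where
  pos : ∀ x r, 0 < r → 0 < φ x r
  meas : AEMeasurable (fun p : EuclideanSpace ℝ (Fin n) × ℝ => φ p.1 p.2)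
    (volume.restrict (univ ×ˢ Ioi 0))
  large : ∀ t : ℝ, 0 < t → ⨆ x : EuclideanSpace ℝ (Fin n),
    essSup (fun r => ballInv Φ x r / ENNReal.ofReal (φ x r)) (volume.restrict (Ioi t)) < ∞
  small : ∀ t : ℝ, 0 < t → ⨆ x : EuclideanSpace ℝ (Fin n),
    essSup (fun r => (ENNReal.ofReal (φ x r))⁻¹) (volume.restrict (Ioo 0 t)) < ∞

/-- The condition
`sup_{r<t<∞} Φ⁻¹(|B(x,t)|⁻¹) essinf_{t<s<∞} φ(x,s) / Φ⁻¹(|B(x,s)|⁻¹) ≤ C φ(x,r)`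
with `C` independent of `x` and `r`. -/
def MaxCondition (Φ : ℝ≥0 → ℝ≥0∞) (φ : EuclideanSpace ℝ (Fin n) → ℝ → ℝ) : Prop :=
  ∃ C : ℝ≥0, ∀ (x : EuclideanSpace ℝ (Fin n)) (r : ℝ), 0 < r →
    ⨆ (t : ℝ) (_ : r < t), ballInv Φ x t *
        essInf (fun s => ENNReal.ofReal (φ x s) / ballInv Φ x s) (volume.restrict (Ioi t))
      ≤ C * ENNReal.ofReal (φ x r)

/-- Almost increasing functions on `(0,∞)`. -/
def AlmostIncreasing (ψ : ℝ → ℝ≥0∞) : Prop :=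
  ∃ C : ℝ≥0, 0 < C ∧ ∀ r s : ℝ, 0 < r → r ≤ s → ψ r ≤ C * ψ s

/-- Almost decreasing functions on `(0,∞)`. -/
def AlmostDecreasing (ψ : ℝ → ℝ≥0∞) : Prop :=
  ∃ C : ℝ≥0, 0 < C ∧ ∀ r s : ℝ, 0 < r → r ≤ s → C * ψ s ≤ ψ r

/-- The class `G_Φ` (in dimension `n`) of almost decreasing `φ : (0,∞) → (0,∞)` such that
`t ↦ φ(t) / Φ⁻¹(t⁻ⁿ)` is almost increasing. -/
structure MemG (n : ℕ) (Φ : ℝ≥0 → ℝ≥0∞) (φ : ℝ → ℝ) : Prop where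
  pos : ∀ r, 0 < r → 0 < φ r
  almostDecreasing : AlmostDecreasing fun t => ENNReal.ofReal (φ t)
  almostIncreasing : AlmostIncreasing fun t =>
    ENNReal.ofReal (φ t) / youngInv Φ (ENNReal.ofReal t ^ n)⁻¹

/-- The condition `t^α φ(t) + sup_{t<r<∞} r^α φ(r) ≤ C φ(t)^β` for all `t > 0`. -/
def SupCondition (α β : ℝ) (φ : ℝ → ℝ) : Prop :=
  ∃ C : ℝ≥0, ∀ t : ℝ, 0 < t →
    ENNReal.ofReal (t ^ α * φ t) + ⨆ (r : ℝ) (_ : t < r), ENNReal.ofReal (r ^ α * φ r)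
      ≤ C * ENNReal.ofReal (φ t ^ β)

/-- The condition `t^α φ(t) ≤ C φ(t)^β` for all `t > 0`. -/
def PowerCondition (α β : ℝ) (φ : ℝ → ℝ) : Prop :=
  ∃ C : ℝ, 0 < C ∧ ∀ t : ℝ, 0 < t → t ^ α * φ t ≤ C * φ t ^ β

end OrliczMorrey

end

/-! Write `M` for the maximal function `hlMax`. Sufficiency is a Hedberg argument. The average of
`|f|` over `B(y,t)` is at most `M f(y)`, and by `IsYoung.average_le` at most `2 φ(t) ‖f‖` with the
Morrey norm of `f`. Taking the first bound to the power `β` and the second to the power `1 - β`,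
condition (∗), i.e. `t^α φ(t)^(1-β) ≤ C`, yields `M_α f ≤ c ‖f‖^(1-β) (M f)^β`
(`exists_fracMax_le_mul_rpow_hlMax`). As `Ψ(t) = Φ(t^(1/β))`, both `Ψ⁻¹` and the weak quasinorm turn
this power `β` into a power `β` of the corresponding quantity for `Φ`, and it remains to bound `M`
from `M^{Φ,φ}` to `WM^{Φ,φ}`.

For that, on `B(x,r)` small balls see only `f` on `B(x,2r)`, which a Vitali covering combined with a
weak Jensen inequality handles; large balls contribute averages that `MaxCondition` bounds by `φ(r)
‖f‖` (`IsYoung.mul_measure_indicator_hlMax_le_one`). Kolmogorov's inequality gives the local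
integrability of `M_α f`. An almost decreasing `φ` satisfies `MaxCondition`, which brings the third
assertion under the same argument.

Necessity tests on the indicator of `B(0,s)`: its Morrey norm is at most a constant times `1/φ(s)`,
while its fractional maximal function is at least a constant times `s^α` on the ball. -/

namespace OrliczMorrey

/-! ### Convexity inequalities for Young functions. -/

namespace IsYoung

variable {Φ : ℝ≥0 → ℝ≥0∞}

theorem map_mul_le (h : IsYoung Φ) {c : ℝ≥0} (hc : c ≤ 1) (r : ℝ≥0) : Φ (c * r) ≤ c * Φ r := by
  have := h.convex.2 (mem_univ r) (mem_univ 0) (zero_le (a := c)) (zero_le (a := 1 - c))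
    (add_tsub_cancel_of_le hc)
  simpa [h.zero, ENNReal.smul_def] using this

theorem mul_map_le (h : IsYoung Φ) {c : ℝ≥0} (hc : 1 ≤ c) (r : ℝ≥0) : c * Φ r ≤ Φ (c * r) := by
  have hc0 : c ≠ 0 := (zero_lt_one.trans_le hc).ne'
  have := h.map_mul_le (inv_le_one_of_one_le₀ hc) (c * r)
  rw [inv_mul_cancel_left₀ hc0] at this
  calc (c : ℝ≥0∞) * Φ r ≤ c * ((c⁻¹ : ℝ≥0) * Φ (c * r)) := by gcongr
    _ = Φ (c * r) := by
      rw [← mul_assoc, ← ENNReal.coe_mul, mul_inv_cancel₀ hc0, ENNReal.coe_one, one_mul]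

theorem mono (h : IsYoung Φ) : Monotone Φ := by
  intro a b hab
  rcases eq_or_ne b 0 with rfl | hb
  · rw [le_zero_iff.1 hab]
  · have := h.map_mul_le (c := a / b) (div_le_one_of_le₀ hab zero_le) b
    rw [div_mul_cancel₀ _ hb] at this
    refine this.trans (mul_le_of_le_one_left' ?_)
    exact_mod_cast div_le_one_of_le₀ hab zero_le

theorem exists_gt (h : IsYoung Φ) {s : ℝ≥0∞} (hs : s < ∞) : ∃ r, s < Φ r :=
  (h.tendsto_top.eventually (lt_mem_nhds hs)).exists

theorem exists_pos_lt (h : IsYoung Φ) {s : ℝ≥0∞} (hs : 0 < s) : ∃ r, 0 < r ∧ Φ r < s := by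
  obtain ⟨r, h1, h2⟩ := ((h.tendsto_zero.eventually (gt_mem_nhds hs)).and
    self_mem_nhdsWithin).exists
  exact ⟨r, h2, h1⟩

/-- `Φ(r)/r` is nondecreasing, so for `r > u` the graph lies above the line through the origin and
`(u, Φ u)`. Lowering that line to vanish at `u` and truncating gives a minorant valid for all `r`.
-/
theorem sub_mul_le (h : IsYoung Φ) (u r : ℝ≥0) : Φ u * ((r : ℝ≥0∞) - u) ≤ u * Φ r := by
  rcases le_or_gt r u with hr | hr
  · rw [tsub_eq_zero_of_le (by exact_mod_cast hr), mul_zero]; exact zero_le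
  · rcases eq_or_ne u 0 with rfl | hu
    · simp [h.zero]
    have h1 := h.mul_map_le (c := r / u) ((one_le_div₀ (pos_iff_ne_zero.2 hu)).2 hr.le) u
    rw [div_mul_cancel₀ _ hu] at h1
    calc Φ u * ((r : ℝ≥0∞) - u) ≤ Φ u * r := by gcongr; exact tsub_le_self
      _ = u * ((r / u : ℝ≥0) * Φ u) := by
        rw [← mul_assoc, ← ENNReal.coe_mul, mul_div_cancel₀ _ hu, mul_comm]
      _ ≤ u * Φ r := by gcongr

/-- A weak Jensen inequality: the factor 2 pays for replacing a supporting line by the minorant of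
`sub_mul_le`. It allows `Φ u = ∞` and a non-measurable `g`. -/
theorem map_mul_measure_le_lintegral (h : IsYoung Φ) {X : Type*} [MeasurableSpace X]
    (μ : Measure X) [IsFiniteMeasure μ] {u : ℝ≥0} {g : X → ℝ≥0}
    (hg : 2 * u * μ univ < ∫⁻ x, g x ∂μ) : Φ u * μ univ ≤ ∫⁻ x, Φ (g x) ∂μ := by
  rcases eq_or_ne u 0 with rfl | hu
  · simp [h.zero]
  have hu' : (u : ℝ≥0∞) ≠ 0 := by exact_mod_cast hu
  have h1 : ∫⁻ x, g x ∂μ ≤ u * μ univ + ∫⁻ x, ((g x : ℝ≥0∞) - u) ∂μ := by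
    rw [← lintegral_const, ← lintegral_add_left measurable_const]
    exact lintegral_mono fun x => le_add_tsub
  have h2 : u * μ univ ≤ ∫⁻ x, ((g x : ℝ≥0∞) - u) ∂μ := by
    have hfin : u * μ univ ≠ ∞ := ENNReal.mul_ne_top ENNReal.coe_ne_top (measure_ne_top _ _)
    have h3 := (hg.trans_le h1).le
    rw [mul_assoc, two_mul] at h3
    exact (ENNReal.add_le_add_iff_left hfin).1 h3
  have h4 : u * (Φ u * μ univ) ≤ u * ∫⁻ x, Φ (g x) ∂μ := by
    calc u * (Φ u * μ univ) = Φ u * (u * μ univ) := by ring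
      _ ≤ Φ u * ∫⁻ x, ((g x : ℝ≥0∞) - u) ∂μ := by gcongr
      _ ≤ ∫⁻ x, Φ u * ((g x : ℝ≥0∞) - u) ∂μ := lintegral_const_mul_le _ _
      _ ≤ ∫⁻ x, u * Φ (g x) ∂μ := lintegral_mono fun x => h.sub_mul_le u (g x)
      _ = u * ∫⁻ x, Φ (g x) ∂μ := lintegral_const_mul' _ _ ENNReal.coe_ne_top
  exact (ENNReal.mul_le_mul_iff_right hu' ENNReal.coe_ne_top).1 h4

end IsYoung

/-! ### The generalized inverse. -/

section youngInv

variable {Φ : ℝ≥0 → ℝ≥0∞}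

theorem le_youngInv (h : Monotone Φ) {u : ℝ≥0} {s : ℝ≥0∞} (hu : Φ u ≤ s) :
    (u : ℝ≥0∞) ≤ youngInv Φ s :=
  le_iInf₂ fun _ hr => ENNReal.coe_le_coe.2 (h.reflect_lt (hu.trans_lt hr)).le

/-- Immediate from the infimum because the inequality is strict; at equality left-continuity would
enter. Later uses secure strictness at the price of a constant factor. -/
theorem map_le_of_lt_youngInv {u : ℝ≥0} {s : ℝ≥0∞} (hu : (u : ℝ≥0∞) < youngInv Φ s) :
    Φ u ≤ s := by
  by_contra! hs
  exact absurd (iInf₂_le u hs) hu.not_ge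

theorem youngInv_mono : Monotone (youngInv Φ) := fun _ _ hst =>
  le_iInf₂ fun r hr => iInf₂_le r (hst.trans_lt hr)

theorem IsYoung.youngInv_lt_top (h : IsYoung Φ) {s : ℝ≥0∞} (hs : s < ∞) : youngInv Φ s < ∞ := by
  obtain ⟨r, hr⟩ := h.exists_gt hs
  exact (iInf₂_le r hr).trans_lt ENNReal.coe_lt_top

theorem IsYoung.youngInv_pos (h : IsYoung Φ) {s : ℝ≥0∞} (hs : 0 < s) : 0 < youngInv Φ s := by
  obtain ⟨r, hr, hrs⟩ := h.exists_pos_lt hs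
  exact (ENNReal.coe_pos.2 hr).trans_le (le_youngInv h.mono hrs.le)

/-- Dual to `c Φ(r) ≤ Φ(c r)`. This is the source of the doubling property of `ballInv`. -/
theorem IsYoung.youngInv_mul_le (h : IsYoung Φ) {c : ℝ≥0} (hc : 1 ≤ c) (s : ℝ≥0∞) :
    youngInv Φ (c * s) ≤ c * youngInv Φ s := by
  have hc0 : (c : ℝ≥0∞) ≠ 0 := by exact_mod_cast (zero_lt_one.trans_le hc).ne'
  suffices youngInv Φ (c * s) / c ≤ youngInv Φ s from
    ((ENNReal.div_le_iff_le_mul (Or.inl hc0) (Or.inl ENNReal.coe_ne_top)).1 this).trans_eq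
      (mul_comm _ _)
  refine le_iInf₂ fun r hr => ENNReal.div_le_of_le_mul' ?_
  refine (iInf₂_le (c * r) ?_).trans (by simp)
  exact ((ENNReal.mul_lt_mul_iff_right hc0 ENNReal.coe_ne_top).2 hr).trans_le (h.mul_map_le hc r)

theorem youngInv_rpow {Ψ : ℝ≥0 → ℝ≥0∞} {β : ℝ} (hβ : 0 < β)
    (hΨ : ∀ t, Ψ t = Φ (t ^ (1 / β))) (s : ℝ≥0∞) : youngInv Ψ s = youngInv Φ s ^ β := by
  refine le_antisymm ?_ (le_iInf₂ fun r hr => ?_)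
  · rw [← ENNReal.rpow_inv_le_iff hβ]
    refine le_iInf₂ fun r hr => ?_
    rw [ENNReal.rpow_inv_le_iff hβ, ← ENNReal.coe_rpow_of_nonneg _ hβ.le]
    refine iInf₂_le (r ^ β) ?_
    rwa [hΨ, ← NNReal.rpow_mul, mul_one_div_cancel hβ.ne', NNReal.rpow_one]
  · rw [← ENNReal.le_rpow_inv_iff hβ, ← ENNReal.coe_rpow_of_nonneg _ (by positivity)]
    rw [hΨ, one_div] at hr
    exact iInf₂_le (r ^ β⁻¹) hr

end youngInv

end OrliczMorrey

/-! ### The Hardy–Littlewood maximal function: measurability, weak-type bounds, Kolmogorov. -/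

namespace OrliczMorrey

section HardyLittlewood

variable {E : Type*} [NormedAddCommGroup E] [MeasurableSpace E] (μ : Measure E)

/-- An open ball is exhausted by slightly smaller concentric balls, and each of these stays inside
`B(y,t)` for `y` near `x`. -/
theorem lowerSemicontinuous_setLIntegral_ball (h : E → ℝ≥0∞) (t : ℝ) :
    LowerSemicontinuous fun x => ∫⁻ y in Metric.ball x t, h y ∂μ := by
  intro x c hc
  have hU : Metric.ball x t = ⋃ k : ℕ, Metric.ball x (t - 1 / ((k : ℝ) + 1)) := by
    refine subset_antisymm (fun y hy => ?_)
      (iUnion_subset fun k => Metric.ball_subset_ball (sub_le_self _ (by positivity)))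
    obtain ⟨k, hk⟩ := exists_nat_one_div_lt (sub_pos.2 (Metric.mem_ball.1 hy))
    exact mem_iUnion.2 ⟨k, Metric.mem_ball.2 (by linarith)⟩
  have hm : Monotone fun k : ℕ => Metric.ball x (t - 1 / ((k : ℝ) + 1)) := fun i j hij =>
    Metric.ball_subset_ball (sub_le_sub_left (one_div_le_one_div_of_le (by positivity)
      (by exact_mod_cast Nat.succ_le_succ hij)) _)
  replace hc : c < ∫⁻ y in Metric.ball x t, h y ∂μ := hc
  rw [hU, setLIntegral_iUnion_of_directed _ hm.directed_le] at hc
  obtain ⟨k, hk⟩ := lt_iSup_iff.1 hc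
  filter_upwards [Metric.ball_mem_nhds x (Nat.one_div_pos_of_nat (n := k) (α := ℝ))] with y hy
  refine hk.trans_le (lintegral_mono_set (Metric.ball_subset_ball' ?_))
  rw [Metric.mem_ball, dist_comm] at hy
  linarith

/-- The centred Hardy–Littlewood maximal function of `g ≥ 0`. -/
noncomputable def hlMax (g : E → ℝ≥0∞) (x : E) : ℝ≥0∞ :=
  ⨆ (t : ℝ) (_ : 0 < t), (μ (Metric.ball x t))⁻¹ * ∫⁻ y in Metric.ball x t, g y ∂μ

theorem exists_average_gt {g : E → ℝ≥0∞} {x : E} {a : ℝ≥0∞} (hx : a < hlMax μ g x) :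
    ∃ t : ℝ, 0 < t ∧ a < (μ (Metric.ball x t))⁻¹ * ∫⁻ y in Metric.ball x t, g y ∂μ := by
  obtain ⟨t, hx⟩ := lt_iSup_iff.1 hx
  obtain ⟨ht, hx⟩ := lt_iSup_iff.1 hx
  exact ⟨t, ht, hx⟩

theorem hlMax_const_mul {c : ℝ≥0∞} (hc : c ≠ ∞) (g : E → ℝ≥0∞) (x : E) :
    hlMax μ (fun y => c * g y) x = c * hlMax μ g x := by
  simp_rw [hlMax, ENNReal.mul_iSup, lintegral_const_mul' _ _ hc, mul_left_comm]

theorem average_le_hlMax (g : E → ℝ≥0∞) (x : E) {t : ℝ} (ht : 0 < t) :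
    (μ (Metric.ball x t))⁻¹ * ∫⁻ y in Metric.ball x t, g y ∂μ ≤ hlMax μ g x :=
  le_iSup₂_of_le t ht le_rfl

variable [BorelSpace E] [μ.IsAddHaarMeasure]

theorem measurable_hlMax (g : E → ℝ≥0∞) : Measurable (hlMax μ g) := by
  refine LowerSemicontinuous.measurable ?_
  refine lowerSemicontinuous_iSup fun t => lowerSemicontinuous_iSup fun ht => ?_
  simp_rw [Measure.addHaar_ball_center μ _ t]
  have hne : (μ (Metric.ball (0 : E) t))⁻¹ ≠ ∞ :=
    ENNReal.inv_ne_top.2 (Metric.measure_ball_pos μ _ ht).ne'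
  exact (ENNReal.continuous_const_mul hne).comp_lowerSemicontinuous
    (lowerSemicontinuous_setLIntegral_ball μ g t) (fun _ _ h => mul_le_mul_right h _)

variable [NormedSpace ℝ E] [FiniteDimensional ℝ E] [Nontrivial E]

open Module in
-- Vitali covering with factor 5. Keeping `h` and `a` abstract lets one argument serve both the weak
-- (1,1) bound (`h = g`) and the Orlicz modular bound (`h = Φ ∘ g`, `a = Φ u`).
theorem mul_measure_le_of_ball_average {h : E → ℝ≥0∞} {S : Set E} {a : ℝ≥0∞}
    (hS : ∀ x ∈ S, ∃ t : ℝ, 0 < t ∧ a * μ (Metric.ball x t) ≤ ∫⁻ y in Metric.ball x t, h y ∂μ) :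
    a * μ S ≤ 5 ^ finrank ℝ E * ∫⁻ y, h y ∂μ := by
  rcases eq_or_ne a 0 with rfl | ha
  · simp
  rcases eq_or_ne (∫⁻ y, h y ∂μ) ∞ with hI | hI
  · rw [hI, ENNReal.mul_top (by simp)]; exact le_top
  choose! t ht hat using hS
  have hd : finrank ℝ E ≠ 0 := finrank_pos.ne'
  set v := μ (Metric.ball (0 : E) 1) with hv
  have hv0 : v ≠ 0 := (Metric.measure_ball_pos μ _ one_pos).ne'
  have hvt : v ≠ ∞ := measure_ball_lt_top.ne
  set K := (∫⁻ y, h y ∂μ) / (a * v) with hK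
  have hKt : K ≠ ∞ := ENNReal.div_ne_top hI (mul_ne_zero ha hv0)
  -- Vitali needs bounded radii: finiteness of the integral bounds `t ^ d` by `K`, and `t ≤ t ^ d`
  -- once `t > 1`.
  have hR : ∀ x ∈ S, t x ≤ max 1 K.toReal := by
    intro x hx
    rcases le_or_gt (t x) 1 with h1 | h1
    · exact h1.trans (le_max_left _ _)
    refine le_max_of_le_right ((le_self_pow₀ h1.le hd).trans ?_)
    refine (ENNReal.ofReal_le_iff_le_toReal hKt).1 ?_
    have h2 := (hat x hx).trans (setLIntegral_le_lintegral _ _)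
    rw [Measure.addHaar_ball μ x (ht x hx).le] at h2
    rw [hK, ENNReal.le_div_iff_mul_le (Or.inl (mul_ne_zero ha hv0)) (Or.inr hI)]
    calc _ = a * (ENNReal.ofReal (t x ^ finrank ℝ E) * v) := by ring
      _ ≤ _ := h2
  obtain ⟨u, huS, hdis, hcov⟩ := Vitali.exists_disjoint_subfamily_covering_enlargement_closedBall
    S id t _ hR 5 (by norm_num)
  have hucount : u.Countable := hdis.countable_of_nonempty_interior fun x hx =>
    ⟨x, Metric.ball_subset_interior_closedBall (Metric.mem_ball_self (ht x (huS hx)))⟩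
  have hsub : S ⊆ ⋃ x ∈ u, Metric.closedBall x (5 * t x) := fun x hx => by
    obtain ⟨b, hb, hxb⟩ := hcov x hx
    exact mem_iUnion₂.2 ⟨b, hb, hxb (Metric.mem_closedBall_self (ht x hx).le)⟩
  have : Countable u := hucount.to_subtype
  calc a * μ S ≤ a * ∑' x : u, μ (Metric.closedBall (x : E) (5 * t x)) := by
        gcongr
        exact (measure_mono hsub).trans (measure_biUnion_le μ hucount _)
    _ = ∑' x : u, 5 ^ finrank ℝ E * (a * μ (Metric.ball (x : E) (t x))) := by
        rw [← ENNReal.tsum_mul_left]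
        refine tsum_congr fun x => ?_
        have htx := (ht x (huS x.2)).le
        rw [Measure.addHaar_closedBall μ _ (by positivity), Measure.addHaar_ball μ _ htx, mul_pow,
          ENNReal.ofReal_mul (by positivity), ENNReal.ofReal_pow (by norm_num)]
        simp only [ENNReal.ofReal_ofNat]
        ring
    _ ≤ ∑' x : u, 5 ^ finrank ℝ E * ∫⁻ y in Metric.closedBall (x : E) (t x), h y ∂μ := by
        gcongr with x
        exact (hat x (huS x.2)).trans (lintegral_mono_set Metric.ball_subset_closedBall)
    _ = 5 ^ finrank ℝ E * ∫⁻ y in ⋃ x ∈ u, Metric.closedBall x (t x), h y ∂μ := by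
        rw [ENNReal.tsum_mul_left]
        exact congrArg _
          (lintegral_biUnion hucount (fun _ _ => measurableSet_closedBall) hdis h).symm
    _ ≤ _ := by gcongr; exact Measure.restrict_le_self

open Module in
theorem mul_measure_hlMax_gt_le (g : E → ℝ≥0∞) (a : ℝ≥0∞) :
    a * μ {x | a < hlMax μ g x} ≤ 5 ^ finrank ℝ E * ∫⁻ y, g y ∂μ := by
  refine mul_measure_le_of_ball_average μ fun x hx => ?_
  obtain ⟨t, ht, hx⟩ := exists_average_gt μ hx
  refine ⟨t, ht, ?_⟩
  rw [← ENNReal.div_eq_inv_mul] at hx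
  exact ((ENNReal.lt_div_iff_mul_lt (Or.inl (Metric.measure_ball_pos μ _ ht).ne')
    (Or.inl measure_ball_lt_top.ne)).1 hx).le

theorem IsYoung.mul_measure_hlMax_gt_le {Φ : ℝ≥0 → ℝ≥0∞} (h : IsYoung Φ) (g : E → ℝ≥0)
    (u : ℝ≥0) : Φ u * μ {x | 2 * (u : ℝ≥0∞) < hlMax μ (fun y => (g y : ℝ≥0∞)) x} ≤
      5 ^ Module.finrank ℝ E * ∫⁻ y, Φ (g y) ∂μ := by
  refine mul_measure_le_of_ball_average μ fun x hx => ?_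
  obtain ⟨t, ht, hx⟩ := exists_average_gt μ hx
  refine ⟨t, ht, ?_⟩
  rw [← ENNReal.div_eq_inv_mul] at hx
  have := (ENNReal.lt_div_iff_mul_lt (Or.inl (Metric.measure_ball_pos μ _ ht).ne')
    (Or.inl measure_ball_lt_top.ne)).1 hx
  have hfin : IsFiniteMeasure (μ.restrict (Metric.ball x t)) :=
    isFiniteMeasure_restrict.2 measure_ball_lt_top.ne
  have h2 := h.map_mul_measure_le_lintegral (μ.restrict (Metric.ball x t)) (u := u) (g := g)
    (by rwa [Measure.restrict_apply_univ])
  rwa [Measure.restrict_apply_univ] at h2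

/-- Kolmogorov's inequality, in qualitative form. -/
theorem setLIntegral_hlMax_rpow_lt_top {g : E → ℝ≥0∞} (hg : ∫⁻ y, g y ∂μ < ∞) {s : Set E}
    (hs : μ s < ∞) {β : ℝ} (hβ0 : 0 < β) (hβ : β < 1) :
    ∫⁻ x in s, hlMax μ g x ^ β ∂μ < ∞ := by
  have hM := measurable_hlMax μ g
  set D := 5 ^ Module.finrank ℝ E * ∫⁻ y, g y ∂μ with hD
  have hDt : D < ∞ := ENNReal.mul_lt_top (by simp) hg
  -- Dyadic layers: some `k` has `2^k ≤ m < 2^(k+1)` when `1 < m < ∞`. The level `2^k / 2` leaves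
  -- room for the strict inequality; at `m = ∞` every term is at least 1 and the series diverges.
  have hpt : ∀ m : ℝ≥0∞, m ^ β ≤
      1 + ∑' k : ℕ, {m : ℝ≥0∞ | 2 ^ k / 2 < m}.indicator (fun _ => ((2 : ℝ≥0∞) ^ (k + 1)) ^ β) m := by
    intro m
    rcases le_or_gt m 1 with h1 | h1
    · exact (ENNReal.rpow_le_one h1 hβ0.le).trans le_self_add
    refine le_add_of_le_right ?_
    induction m with
    | top =>
      have hlt : ∀ k : ℕ, (2 : ℝ≥0∞) ^ k / 2 < ∞ := fun k =>
        ENNReal.div_lt_top (by finiteness) (by norm_num)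
      have : ∑' _ : ℕ, (1 : ℝ≥0∞) = ∞ := ENNReal.tsum_const_eq_top_of_ne_zero one_ne_zero
      refine le_top.trans (this.ge.trans ?_)
      refine ENNReal.tsum_le_tsum fun k => ?_
      rw [indicator_of_mem (show ∞ ∈ {m : ℝ≥0∞ | 2 ^ k / 2 < m} from hlt k)]
      exact ENNReal.one_le_rpow (one_le_pow₀ one_le_two) hβ0
    | coe m =>
      obtain ⟨k, hk1, hk2⟩ := exists_nat_pow_near (x := m) (y := 2) (by exact_mod_cast h1.le)
        one_lt_two
      refine le_trans ?_ (ENNReal.le_tsum k)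
      rw [indicator_of_mem]
      · refine ENNReal.rpow_le_rpow ?_ hβ0.le
        exact_mod_cast hk2.le
      · refine lt_of_lt_of_le (ENNReal.half_lt_self (by simp) (by finiteness)) ?_
        exact_mod_cast hk1
  -- With the weak (1,1) bound the layers form a geometric series of ratio `2^(β-1)`, convergent
  -- since `β < 1`.
  have hq : ∀ k : ℕ, ((2 : ℝ≥0∞) ^ (k + 1)) ^ β * (2 ^ k / 2)⁻¹ =
      2 ^ β * 2 * ((2 : ℝ≥0∞) ^ (β - 1)) ^ k := by
    intro k
    rw [ENNReal.inv_div (by simp) (by simp), ← ENNReal.rpow_natCast, ← ENNReal.rpow_mul,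
      ← ENNReal.rpow_natCast, ← ENNReal.rpow_mul_natCast, ENNReal.div_eq_inv_mul,
      ← ENNReal.rpow_neg, mul_comm _ (2 : ℝ≥0∞), ← mul_assoc, mul_comm _ (2 : ℝ≥0∞), mul_assoc,
      mul_comm _ (2 : ℝ≥0∞), mul_assoc,
      ← ENNReal.rpow_add _ _ (by norm_num) (by norm_num),
      ← ENNReal.rpow_add _ _ (by norm_num) (by norm_num)]
    congr 2
    push_cast
    ring
  calc ∫⁻ x in s, hlMax μ g x ^ β ∂μ
      ≤ ∫⁻ x in s, (1 + ∑' k : ℕ, {x | 2 ^ k / 2 < hlMax μ g x}.indicator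
          (fun _ => ((2 : ℝ≥0∞) ^ (k + 1)) ^ β) x) ∂μ := lintegral_mono fun x => hpt _
    _ = μ s + ∑' k : ℕ, ∫⁻ x in s, {x | 2 ^ k / 2 < hlMax μ g x}.indicator
          (fun _ => ((2 : ℝ≥0∞) ^ (k + 1)) ^ β) x ∂μ := by
        rw [lintegral_add_left measurable_const, lintegral_tsum fun k =>
          (measurable_const.indicator (measurableSet_lt measurable_const hM)).aemeasurable]
        simp
    _ ≤ μ s + ∑' k : ℕ, 2 ^ β * 2 * ((2 : ℝ≥0∞) ^ (β - 1)) ^ k * D := by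
        gcongr with k
        rw [lintegral_indicator_const (measurableSet_lt measurable_const hM), ← hq, mul_assoc]
        gcongr
        rw [← ENNReal.div_eq_inv_mul, ENNReal.le_div_iff_mul_le (by simp) (by left; finiteness),
          mul_comm]
        refine le_trans ?_ (mul_measure_hlMax_gt_le μ g (2 ^ k / 2))
        gcongr
        exact Measure.restrict_le_self
    _ < ∞ := by
        rw [ENNReal.tsum_mul_right, ENNReal.tsum_mul_left, ENNReal.tsum_geometric]
        refine ENNReal.add_lt_top.2 ⟨hs, ENNReal.mul_lt_top (ENNReal.mul_lt_top (by finiteness) ?_)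
          hDt⟩
        rw [lt_top_iff_ne_top, ENNReal.inv_ne_top, ← pos_iff_ne_zero, tsub_pos_iff_lt]
        exact ENNReal.rpow_lt_one_of_one_lt_of_neg (by norm_num) (by linarith)

end HardyLittlewood

end OrliczMorrey

/-! ### Orlicz norms on balls, and the local/global splitting. -/

namespace OrliczMorrey

variable {n : ℕ} {Φ : ℝ≥0 → ℝ≥0∞}

section ballInv

theorem volume_ball_pos (x : EuclideanSpace ℝ (Fin n)) {r : ℝ} (hr : 0 < r) :
    0 < volume (Metric.ball x r) := Metric.measure_ball_pos _ _ hr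

theorem volume_ball_lt_top (x : EuclideanSpace ℝ (Fin n)) (r : ℝ) :
    volume (Metric.ball x r) < ∞ := measure_ball_lt_top

theorem IsYoung.ballInv_pos (h : IsYoung Φ) (x : EuclideanSpace ℝ (Fin n)) (r : ℝ) :
    0 < ballInv Φ x r :=
  h.youngInv_pos (ENNReal.inv_pos.2 (volume_ball_lt_top x r).ne)

theorem IsYoung.ballInv_lt_top (h : IsYoung Φ) (x : EuclideanSpace ℝ (Fin n)) {r : ℝ}
    (hr : 0 < r) : ballInv Φ x r < ∞ :=
  h.youngInv_lt_top (ENNReal.inv_lt_top.2 (volume_ball_pos x hr))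

theorem ballInv_anti (x : EuclideanSpace ℝ (Fin n)) {r s : ℝ} (hrs : r ≤ s) :
    ballInv Φ x s ≤ ballInv Φ x r :=
  youngInv_mono (ENNReal.inv_le_inv.2 (measure_mono (Metric.ball_subset_ball hrs)))

theorem volume_ball_eq [Nontrivial (EuclideanSpace ℝ (Fin n))] (x : EuclideanSpace ℝ (Fin n))
    {r : ℝ} (hr : 0 ≤ r) : volume (Metric.ball x r) =
      ENNReal.ofReal r ^ n * volume (Metric.ball (0 : EuclideanSpace ℝ (Fin n)) 1) := by
  rw [Measure.addHaar_ball _ _ hr, finrank_euclideanSpace_fin, ENNReal.ofReal_pow hr]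

theorem volume_ball_two_mul [Nontrivial (EuclideanSpace ℝ (Fin n))]
    (x y : EuclideanSpace ℝ (Fin n)) {r : ℝ} (hr : 0 ≤ r) :
    volume (Metric.ball x (2 * r)) = 2 ^ n * volume (Metric.ball y r) := by
  rw [volume_ball_eq x (by positivity), volume_ball_eq y hr, ENNReal.ofReal_mul zero_le_two,
    mul_pow, ENNReal.ofReal_ofNat, mul_assoc]

theorem inv_volume_ball_eq [Nontrivial (EuclideanSpace ℝ (Fin n))]
    (x y : EuclideanSpace ℝ (Fin n)) {r : ℝ} (hr : 0 ≤ r) :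
    (volume (Metric.ball y r))⁻¹ = 2 ^ n * (volume (Metric.ball x (2 * r)))⁻¹ := by
  rw [volume_ball_two_mul x y hr, ENNReal.mul_inv (by simp) (by simp), ← mul_assoc,
    ENNReal.mul_inv_cancel (by simp) (by finiteness), one_mul]

theorem IsYoung.ballInv_le_two_mul [Nontrivial (EuclideanSpace ℝ (Fin n))] (h : IsYoung Φ)
    (x : EuclideanSpace ℝ (Fin n)) {r : ℝ} (hr : 0 ≤ r) :
    ballInv Φ x r ≤ 2 ^ n * ballInv Φ x (2 * r) := by
  have := h.youngInv_mul_le (c := 2 ^ n) (one_le_pow₀ one_le_two)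
    (volume (Metric.ball x (2 * r)))⁻¹
  simpa only [ballInv, inv_volume_ball_eq x x hr, ENNReal.coe_pow, ENNReal.coe_ofNat] using this

end ballInv

section orliczNorm

variable {f g : EuclideanSpace ℝ (Fin n) → ℝ}

theorem lintegral_le_one_of_orliczNorm_lt (h : Monotone Φ) {lam : ℝ≥0}
    (hlam : orliczNorm Φ f < lam) : ∫⁻ x, Φ (‖f x‖₊ / lam) ≤ 1 := by
  simp only [orliczNorm, iInf_lt_iff] at hlam
  obtain ⟨k, hk, hk1, hkl⟩ := hlam
  refine le_trans (lintegral_mono fun x => h ?_) hk1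
  have hkl' : k ≤ lam := by exact_mod_cast hkl.le
  gcongr

theorem orliczNorm_mono (h : Monotone Φ) (hfg : ∀ x, ‖f x‖₊ ≤ ‖g x‖₊) :
    orliczNorm Φ f ≤ orliczNorm Φ g :=
  le_iInf₂ fun lam hlam => le_iInf fun hg => iInf₂_le_of_le lam hlam <| iInf_le_of_le
    ((lintegral_mono fun x => h (by gcongr; exact hfg x)).trans hg) le_rfl

theorem orliczNorm_indicator_mono (h : Monotone Φ) {s t : Set (EuclideanSpace ℝ (Fin n))}
    (hst : s ⊆ t) : orliczNorm Φ (s.indicator f) ≤ orliczNorm Φ (t.indicator f) :=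
  orliczNorm_mono h fun x => norm_indicator_le_of_subset hst f x

/-- Hölder against the indicator of a ball, without the complementary function: if the average of
`|f|/lam` exceeded `2u` for some `u` with `Φ u > |B|⁻¹`, weak Jensen would make the modular of `f
χ_B / lam` exceed 1. -/
theorem IsYoung.average_le (h : IsYoung Φ) (f : EuclideanSpace ℝ (Fin n) → ℝ)
    (x : EuclideanSpace ℝ (Fin n)) {r : ℝ} (hr : 0 < r) :
    (volume (Metric.ball x r))⁻¹ * ∫⁻ y in Metric.ball x r, ‖f y‖ₑ ≤
      2 * (ballInv Φ x r * orliczNorm Φ ((Metric.ball x r).indicator f)) := by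
  set b := Metric.ball x r with hb
  have hb0 : volume b ≠ 0 := (volume_ball_pos x hr).ne'
  have hbt : volume b ≠ ∞ := (volume_ball_lt_top x r).ne
  have hfin : IsFiniteMeasure (volume.restrict b) := isFiniteMeasure_restrict.2 hbt
  have hI0 := (h.ballInv_pos x r).ne'
  have hIt := (h.ballInv_lt_top x hr).ne
  rw [← mul_assoc, mul_comm _ (orliczNorm _ _), ← ENNReal.div_le_iff_le_mul (by simp [hI0])
    (Or.inl (by finiteness))]
  refine le_iInf₂ fun lam hlam => le_iInf fun hf => ?_
  have hlam' : (lam : ℝ≥0∞) ≠ 0 := by exact_mod_cast hlam.ne'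
  refine ENNReal.div_le_of_le_mul' ?_
  rw [mul_right_comm, mul_comm _ (ballInv _ _ _), ← ENNReal.div_le_iff_le_mul (by simp [hlam.ne'])
    (Or.inl (by finiteness))]
  refine le_iInf₂ fun u hu => ENNReal.div_le_of_le_mul' ?_
  have key : ∫⁻ y in b, ((‖f y‖₊ / lam : ℝ≥0) : ℝ≥0∞) ≤ 2 * u * volume b := by
    by_contra! hlt
    have h1 := h.map_mul_measure_le_lintegral (volume.restrict b) (u := u)
      (g := fun y => ‖f y‖₊ / lam) (by rwa [Measure.restrict_apply_univ])
    rw [Measure.restrict_apply_univ] at h1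
    have h2 : ∫⁻ y in b, Φ (‖f y‖₊ / lam) ≤ 1 := by
      refine le_trans ?_ hf
      rw [← lintegral_indicator Metric.isOpen_ball.measurableSet]
      refine lintegral_mono fun y => ?_
      by_cases hy : y ∈ Metric.ball x r <;> simp [b, hy]
    have h3 := (ENNReal.le_div_iff_mul_le (Or.inl hb0) (Or.inl hbt)).2 (h1.trans h2)
    rw [one_div] at h3
    exact h3.not_gt hu
  rw [← ENNReal.div_eq_inv_mul]
  refine ENNReal.div_le_of_le_mul ?_
  have h4 : ∫⁻ y in b, ‖f y‖ₑ = lam * ∫⁻ y in b, ((‖f y‖₊ / lam : ℝ≥0) : ℝ≥0∞) := by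
    rw [← lintegral_const_mul' _ _ ENNReal.coe_ne_top]
    refine lintegral_congr fun y => ?_
    rw [← ENNReal.coe_mul, mul_div_cancel₀ _ hlam.ne']
    rfl
  rw [h4]
  calc lam * ∫⁻ y in b, ((‖f y‖₊ / lam : ℝ≥0) : ℝ≥0∞) ≤ lam * (2 * u * volume b) := by gcongr
    _ = _ := by ring

/-- The 2 is the loss in weak Jensen; the Vitali factor `5 ^ n` moves inside `Φ` by convexity. -/
theorem IsYoung.mul_measure_hlMax_le_one [Nontrivial (EuclideanSpace ℝ (Fin n))] (h : IsYoung Φ)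
    {lam : ℝ≥0} (hlam : 0 < lam) (hf : ∫⁻ x, Φ (‖f x‖₊ / lam) ≤ 1) (τ : ℝ≥0) :
    Φ (τ / (2 * 5 ^ n * lam)) * volume {x | τ < hlMax volume (fun y => ‖f y‖ₑ) x} ≤ 1 := by
  have h1 := h.mul_measure_hlMax_gt_le volume (fun y => ‖f y‖₊ / lam) (τ / (2 * lam))
  have hset : {x | τ < hlMax volume (fun y => ‖f y‖ₑ) x} ⊆
      {x | 2 * ((τ / (2 * lam) : ℝ≥0) : ℝ≥0∞) <
        hlMax volume (fun y => ((‖f y‖₊ / lam : ℝ≥0) : ℝ≥0∞)) x} := by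
    intro x hx
    have hfun : (fun y => ((‖f y‖₊ / lam : ℝ≥0) : ℝ≥0∞)) =
        fun y => ((lam⁻¹ : ℝ≥0) : ℝ≥0∞) * ‖f y‖ₑ := by
      ext y
      rw [div_eq_inv_mul, ENNReal.coe_mul]
      rfl
    have hlt : (τ : ℝ≥0∞) < hlMax volume (fun y => ‖f y‖ₑ) x := hx
    have h2 : 2 * ((τ / (2 * lam) : ℝ≥0) : ℝ≥0∞) = ((lam⁻¹ : ℝ≥0) : ℝ≥0∞) * τ := by
      rw [← ENNReal.coe_ofNat, ← ENNReal.coe_mul, ← ENNReal.coe_mul]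
      congr 1
      field_simp
    change 2 * _ < hlMax volume _ x
    rw [hfun, hlMax_const_mul _ ENNReal.coe_ne_top, h2]
    exact (ENNReal.mul_lt_mul_iff_right (by simp [hlam.ne']) ENNReal.coe_ne_top).2 hlt
  rw [finrank_euclideanSpace_fin] at h1
  have h5 : ((5 : ℝ≥0) ^ n) ≠ 0 := by positivity
  have h3 := h.mul_map_le (c := 5 ^ n) (one_le_pow₀ (by norm_num)) (τ / (2 * 5 ^ n * lam))
  rw [show (5 : ℝ≥0) ^ n * (τ / (2 * 5 ^ n * lam)) = τ / (2 * lam) by field_simp] at h3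
  refine (ENNReal.mul_le_mul_iff_right (a := 5 ^ n) (by simp) (by finiteness)).1 ?_
  calc (5 : ℝ≥0∞) ^ n * (Φ (τ / (2 * 5 ^ n * lam)) *
        volume {x | τ < hlMax volume (fun y => ‖f y‖ₑ) x})
      = ((5 ^ n : ℝ≥0) : ℝ≥0∞) * Φ (τ / (2 * 5 ^ n * lam)) *
        volume {x | τ < hlMax volume (fun y => ‖f y‖ₑ) x} := by push_cast; ring
    _ ≤ _ := mul_le_mul' h3 (measure_mono hset)
    _ ≤ _ := h1
    _ ≤ 5 ^ n * 1 := by gcongr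

end orliczNorm

/-- For `y ∈ B(x,r)`, a ball `B(y,t)` with `t ≤ r` lies in `B(x,2r)`; one with `t > r` lies in
`B(x,2t)`, whose volume is `2 ^ n` times larger. -/
theorem hlMax_le_max [Nontrivial (EuclideanSpace ℝ (Fin n))] {g : EuclideanSpace ℝ (Fin n) → ℝ≥0∞}
    {x y : EuclideanSpace ℝ (Fin n)} {r : ℝ} (hy : y ∈ Metric.ball x r) {K : ℝ≥0∞}
    (hK : ∀ t, r < t → (volume (Metric.ball x t))⁻¹ * ∫⁻ z in Metric.ball x t, g z ≤ K) :
    hlMax volume g y ≤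
      max (hlMax volume ((Metric.ball x (2 * r)).indicator g) y) (2 ^ n * K) := by
  have hyr : dist y x < r := hy
  have hr : 0 < r := dist_nonneg.trans_lt hyr
  refine iSup₂_le fun t ht => ?_
  rcases le_or_gt t r with htr | htr
  · refine le_max_of_le_left (le_trans (le_of_eq ?_) (average_le_hlMax _ _ _ ht))
    congr 1
    refine setLIntegral_congr_fun measurableSet_ball fun z hz => ?_
    rw [indicator_of_mem]
    exact Metric.ball_subset_ball' (by linarith) hz
  · refine le_max_of_le_right ?_
    rw [inv_volume_ball_eq x y ht.le, mul_assoc]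
    gcongr
    refine le_trans ?_ (hK (2 * t) (by linarith))
    gcongr
    exact Metric.ball_subset_ball' (by linarith)

end OrliczMorrey

/-! ### The weak Morrey estimate on a ball, and Hedberg's inequality. -/

namespace OrliczMorrey

variable {n : ℕ} {Φ : ℝ≥0 → ℝ≥0∞} {f : EuclideanSpace ℝ (Fin n) → ℝ}

section morreyNorm

variable {φ : EuclideanSpace ℝ (Fin n) → ℝ → ℝ} {x : EuclideanSpace ℝ (Fin n)} {r : ℝ}

theorem ballInv_mul_orliczNorm_le (hφ : 0 < φ x r) (hr : 0 < r) :
    ballInv Φ x r * orliczNorm Φ ((Metric.ball x r).indicator f) ≤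
      ENNReal.ofReal (φ x r) * morreyNorm Φ φ f := by
  have h1 : (ENNReal.ofReal (φ x r))⁻¹ * ballInv Φ x r *
      orliczNorm Φ ((Metric.ball x r).indicator f) ≤ morreyNorm Φ φ f :=
    le_iSup_of_le x (le_iSup₂_of_le r hr le_rfl)
  rw [mul_assoc, ← ENNReal.div_eq_inv_mul] at h1
  exact (ENNReal.div_le_iff_le_mul (Or.inl (by simpa using hφ)) (by simp)).1 h1 |>.trans_eq
    (mul_comm _ _)

/-- The norm of `f` over `B(x,t)` is at most that over `B(x,s)`, hence at most `a φ(s) /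
Φ⁻¹(|B(x,s)|⁻¹)`, for every `s > t`. Passing to the essential infimum in `s` produces the left side
of `MaxCondition`. A positive finite bound `a` replaces the Morrey norm so that it can be divided
out. -/
theorem IsYoung.ballInv_mul_orliczNorm_le_of_lt (h : IsYoung Φ) (hφ : ∀ s, 0 < s → 0 < φ x s)
    {C : ℝ≥0} (hC : ⨆ (t : ℝ) (_ : r < t), ballInv Φ x t *
        essInf (fun s => ENNReal.ofReal (φ x s) / ballInv Φ x s) (volume.restrict (Ioi t))
      ≤ C * ENNReal.ofReal (φ x r)) {a : ℝ≥0} (ha : 0 < a) (hfa : morreyNorm Φ φ f ≤ a)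
    (hr : 0 < r) {t : ℝ} (ht : r < t) :
    ballInv Φ x t * orliczNorm Φ ((Metric.ball x t).indicator f) ≤
      C * ENNReal.ofReal (φ x r) * a := by
  have ha' : (a : ℝ≥0∞) ≠ 0 := by exact_mod_cast ha.ne'
  have h1 : orliczNorm Φ ((Metric.ball x t).indicator f) / a ≤
      essInf (fun s => ENNReal.ofReal (φ x s) / ballInv Φ x s) (volume.restrict (Ioi t)) := by
    refine le_essInf_of_ae_le _ ((ae_restrict_iff' measurableSet_Ioi).2 (ae_of_all _ ?_))
    intro s hs
    have hs0 : 0 < s := hr.trans (ht.trans hs)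
    rw [ENNReal.le_div_iff_mul_le (Or.inl (h.ballInv_pos x s).ne')
      (Or.inl (h.ballInv_lt_top x hs0).ne), ENNReal.mul_comm_div,
      ENNReal.div_eq_inv_mul, mul_left_comm, ← ENNReal.div_eq_inv_mul]
    refine ENNReal.div_le_of_le_mul ?_
    calc _ ≤ ballInv Φ x s * orliczNorm Φ ((Metric.ball x s).indicator f) := by
          rw [mul_comm]
          gcongr
          exact orliczNorm_indicator_mono h.mono (Metric.ball_subset_ball (le_of_lt hs))
      _ ≤ _ := ballInv_mul_orliczNorm_le (hφ s hs0) hs0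
      _ ≤ _ := by gcongr
  have h2 := (le_iSup₂_of_le (f := fun (t : ℝ) (_ : r < t) => ballInv Φ x t *
    essInf (fun s => ENNReal.ofReal (φ x s) / ballInv Φ x s) (volume.restrict (Ioi t))) t ht
    (mul_le_mul_right h1 _)).trans hC
  rw [← mul_div_assoc] at h2
  exact (ENNReal.div_le_iff_le_mul (Or.inl ha') (Or.inl ENNReal.coe_ne_top)).1 h2

theorem IsYoung.mul_measure_indicator_hlMax_le_one [Nontrivial (EuclideanSpace ℝ (Fin n))]
    (h : IsYoung Φ) {p b : ℝ≥0} (hp : ballInv Φ x r = p) (hb : 0 < b) (hr : 0 < r)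
    (hf : ∀ t, r < t → ballInv Φ x t * orliczNorm Φ ((Metric.ball x t).indicator f) ≤ b)
    (τ : ℝ≥0) :
    Φ (τ / (4 * 10 ^ n * b / p)) * volume {y | τ < (Metric.ball x r).indicator
      (hlMax volume fun z => ‖f z‖ₑ) y} ≤ 1 := by
  have hp0 : 0 < p := ENNReal.coe_pos.1 (hp ▸ h.ballInv_pos x r)
  have hset : {y | (τ : ℝ≥0∞) < (Metric.ball x r).indicator (hlMax volume fun z => ‖f z‖ₑ) y} ⊆
      {y | (τ : ℝ≥0∞) < hlMax volume (fun z => ‖f z‖ₑ) y} ∩ Metric.ball x r := by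
    intro y hy
    replace hy : (τ : ℝ≥0∞) < (Metric.ball x r).indicator (hlMax volume fun z => ‖f z‖ₑ) y := hy
    by_cases hyb : y ∈ Metric.ball x r
    · rw [indicator_of_mem hyb] at hy
      exact ⟨hy, hyb⟩
    · simp [hyb] at hy
  refine (mul_le_mul_right (measure_mono hset) _).trans ?_
  have hK : ∀ y ∈ Metric.ball x r, hlMax volume (fun z => ‖f z‖ₑ) y ≤
      max (hlMax volume (fun z => ‖(Metric.ball x (2 * r)).indicator f z‖ₑ) y)
        (2 ^ n * (2 * b)) := by
    intro y hy
    simp_rw [enorm_indicator_eq_indicator_enorm]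
    refine hlMax_le_max hy fun t ht => ?_
    exact (h.average_le f x (hr.trans ht)).trans (mul_le_mul_right (hf t ht) _)
  -- At high levels the far part cannot exceed `τ`, so only `f` on `B(x,2r)` matters. At low levels
  -- `Φ(...) ≤ |B|⁻¹` and the trivial bound by `|B|` suffices. The constant is `4 * 10 ^ n = (2 * 5
  -- ^ n) * (2 * 2 ^ n)`: the weak-type loss times the doubling loss, with a 2 for strictness.
  rcases le_or_gt ((2 : ℝ≥0) ^ n * (2 * b)) τ with hτ | hτ
  · have hnorm : orliczNorm Φ ((Metric.ball x (2 * r)).indicator f) <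
        ((2 * 2 ^ n * b / p : ℝ≥0) : ℝ≥0∞) := by
      have h1 : (p : ℝ≥0∞) * orliczNorm Φ ((Metric.ball x (2 * r)).indicator f) ≤ 2 ^ n * b := by
        rw [← hp]
        calc _ ≤ 2 ^ n * ballInv Φ x (2 * r) *
              orliczNorm Φ ((Metric.ball x (2 * r)).indicator f) := by
              gcongr
              exact h.ballInv_le_two_mul x hr.le
          _ ≤ 2 ^ n * b := by
              rw [mul_assoc]
              gcongr
              exact hf _ (by linarith)
      refine lt_of_le_of_lt (b := ((2 ^ n * b / p : ℝ≥0) : ℝ≥0∞)) ?_ ?_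
      · rw [ENNReal.coe_div hp0.ne', ENNReal.le_div_iff_mul_le (by simp [hp0.ne']) (by simp),
          mul_comm]
        exact_mod_cast h1
      · rw [ENNReal.coe_lt_coe, mul_assoc, mul_div_assoc 2]
        exact lt_mul_left (by positivity) one_lt_two
    have h2 := h.mul_measure_hlMax_le_one (by positivity)
      (lintegral_le_one_of_orliczNorm_lt h.mono hnorm) τ
    rw [show (2 : ℝ≥0) * 5 ^ n * (2 * 2 ^ n * b / p) = 4 * 10 ^ n * b / p by
      rw [show (10 : ℝ≥0) = 5 * 2 by norm_num, mul_pow]; ring] at h2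
    refine (mul_le_mul_right (measure_mono ?_) _).trans h2
    rintro y ⟨hy, hyb⟩
    have hτ' : (2 : ℝ≥0∞) ^ n * (2 * b) ≤ τ := by exact_mod_cast hτ
    rcases lt_max_iff.1 (lt_of_lt_of_le hy (hK y hyb)) with h3 | h3
    · exact h3
    · exact absurd h3 hτ'.not_gt
  · have h1 : Φ (τ / (4 * 10 ^ n * b / p)) ≤ (volume (Metric.ball x r))⁻¹ := by
      refine map_le_of_lt_youngInv ?_
      change _ < ballInv Φ x r
      rw [hp, ENNReal.coe_lt_coe, div_lt_iff₀ (by positivity), mul_div_cancel₀ _ hp0.ne']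
      refine hτ.trans_le ?_
      rw [← mul_assoc, mul_comm (2 ^ n)]
      gcongr <;> norm_num
    calc _ ≤ (volume (Metric.ball x r))⁻¹ * volume (Metric.ball x r) :=
          mul_le_mul' h1 (measure_mono inter_subset_right)
      _ ≤ 1 := ENNReal.inv_mul_le_one _

end morreyNorm

/-- The substitution `τ = (t/c)^(1/β)` sends `{g > t}` into `{H > τ}` and turns `Ψ(t / (c l^β))`
into `Φ(τ / l)`. -/
theorem weakOrliczNorm_le_mul_rpow {Ψ : ℝ≥0 → ℝ≥0∞} {β : ℝ} (hβ : 0 < β)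
    (hΨ : ∀ t, Ψ t = Φ (t ^ (1 / β))) {g H : EuclideanSpace ℝ (Fin n) → ℝ≥0∞} {c l : ℝ≥0}
    (hc : 0 < c) (hl : 0 < l) (hg : ∀ x, g x ≤ c * H x ^ β)
    (hH : ∀ τ : ℝ≥0, Φ (τ / l) * volume {x | τ < H x} ≤ 1) :
    weakOrliczNorm Ψ g ≤ ((c * l ^ β : ℝ≥0) : ℝ≥0∞) := by
  refine iInf₂_le_of_le (c * l ^ β) (mul_pos hc (NNReal.rpow_pos hl)) (iInf_le_of_le ?_ le_rfl)
  refine iSup₂_le fun t _ => ?_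
  refine le_trans ?_ (hH ((t / c) ^ (1 / β)))
  have he : (t / (c * l ^ β)) ^ (1 / β) = (t / c) ^ (1 / β) / l := by
    rw [← div_div, NNReal.div_rpow, ← NNReal.rpow_mul, mul_one_div_cancel hβ.ne', NNReal.rpow_one]
  rw [hΨ, he]
  refine mul_le_mul_right (measure_mono fun x hx => ?_) _
  replace hx : (t : ℝ≥0∞) < g x := hx
  change (((t / c) ^ (1 / β) : ℝ≥0) : ℝ≥0∞) < H x
  rw [ENNReal.coe_rpow_of_nonneg _ (by positivity), one_div, ENNReal.rpow_inv_lt_iff hβ,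
    ENNReal.coe_div hc.ne']
  refine (ENNReal.div_lt_iff (by simp [hc.ne']) (by simp)).2 ?_
  rw [mul_comm]
  exact hx.trans_le (hg x)

theorem exists_fracMax_le_mul_rpow_hlMax [Nontrivial (EuclideanSpace ℝ (Fin n))] {α β : ℝ}
    (hβ : 0 < β) (hβ1 : β < 1) {φ : ℝ → ℝ} (hφ : ∀ t, 0 < t → 0 < φ t)
    (hP : PowerCondition α β φ) (h : IsYoung Φ) :
    ∃ c : ℝ≥0, 0 < c ∧ ∀ (f : EuclideanSpace ℝ (Fin n) → ℝ) (a : ℝ≥0),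
      morreyNorm Φ (fun _ r => φ r) f ≤ a → ∀ y,
        fracMax α f y ≤ ((c * a ^ (1 - β) : ℝ≥0) : ℝ≥0∞) *
          hlMax volume (fun z => ‖f z‖ₑ) y ^ β := by
  obtain ⟨C, hC, hP⟩ := hP
  have hn : (n : ℝ) ≠ 0 := by
    rw [Nat.cast_ne_zero, ← finrank_euclideanSpace_fin (𝕜 := ℝ) (n := n)]
    exact Module.finrank_pos.ne'
  set v := volume (Metric.ball (0 : EuclideanSpace ℝ (Fin n)) 1) with hv
  have hv0 : v ≠ 0 := (volume_ball_pos _ one_pos).ne'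
  have hvt : v ≠ ∞ := (volume_ball_lt_top _ _).ne
  have hV0 : v ^ (α / n) ≠ 0 := by simp [ENNReal.rpow_eq_zero_iff, hv0, hvt]
  have hVt : v ^ (α / n) ≠ ∞ := ENNReal.rpow_ne_top_of_ne_zero hv0 hvt
  obtain ⟨V, hV⟩ : ∃ V : ℝ≥0, (V : ℝ≥0∞) = v ^ (α / n) := ⟨_, ENNReal.coe_toNNReal hVt⟩
  have hVpos : 0 < V := by
    rw [← hV] at hV0
    exact pos_iff_ne_zero.2 (by exact_mod_cast hV0)
  refine ⟨V * C.toNNReal * 2 ^ (1 - β),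
    mul_pos (mul_pos hVpos (Real.toNNReal_pos.2 hC)) (NNReal.rpow_pos two_pos), ?_⟩
  intro f a hfa y
  refine iSup₂_le fun t ht => ?_
  have hb0 := (volume_ball_pos y ht).ne'
  have hbt := (volume_ball_lt_top y t).ne
  set A := (volume (Metric.ball y t))⁻¹ * ∫⁻ z in Metric.ball y t, ‖f z‖ₑ with hA
  have hA1 : A ≤ hlMax volume (fun z => ‖f z‖ₑ) y := average_le_hlMax _ _ _ ht
  have hA2 : A ≤ 2 * (ENNReal.ofReal (φ t) * a) := by
    refine (h.average_le f y ht).trans (mul_le_mul_right ?_ _)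
    exact (ballInv_mul_orliczNorm_le (φ := fun _ r => φ r) (hφ t ht) ht).trans (by gcongr)
  have hvol : volume (Metric.ball y t) ^ (-1 + α / n) * ∫⁻ z in Metric.ball y t, ‖f z‖ₑ =
      ENNReal.ofReal (t ^ α) * V * A := by
    rw [ENNReal.rpow_add _ _ hb0 hbt, ENNReal.rpow_neg_one, mul_right_comm, ← hA, mul_comm A]
    congr 1
    rw [volume_ball_eq y ht.le, ENNReal.mul_rpow_of_ne_top (by finiteness) hvt, hV,
      ← ENNReal.rpow_natCast, ← ENNReal.rpow_mul, mul_div_cancel₀ _ hn,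
      ENNReal.ofReal_rpow_of_pos ht]
  -- This is (∗) divided by `φ(t)^β`.
  have hPt : ENNReal.ofReal (t ^ α) * ENNReal.ofReal (φ t) ^ (1 - β) ≤ ENNReal.ofReal C := by
    rw [ENNReal.ofReal_rpow_of_pos (hφ t ht), ← ENNReal.ofReal_mul (by positivity)]
    refine ENNReal.ofReal_le_ofReal ?_
    rw [Real.rpow_sub (hφ t ht), Real.rpow_one, ← mul_div_assoc,
      div_le_iff₀ (Real.rpow_pos_of_pos (hφ t ht) _)]
    exact hP t ht
  have hsplit : A = A ^ β * A ^ (1 - β) := by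
    rw [← ENNReal.rpow_add_of_nonneg _ _ hβ.le (by linarith), add_sub_cancel, ENNReal.rpow_one]
  have h1β : 0 ≤ 1 - β := by linarith
  rw [hvol]
  calc ENNReal.ofReal (t ^ α) * V * A
      = ENNReal.ofReal (t ^ α) * V * (A ^ β * A ^ (1 - β)) := by rw [← hsplit]
    _ ≤ ENNReal.ofReal (t ^ α) * V * (hlMax volume (fun z => ‖f z‖ₑ) y ^ β *
          (2 * (ENNReal.ofReal (φ t) * a)) ^ (1 - β)) := by gcongr
    _ = V * (ENNReal.ofReal (t ^ α) * ENNReal.ofReal (φ t) ^ (1 - β)) * 2 ^ (1 - β) *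
          a ^ (1 - β) * hlMax volume (fun z => ‖f z‖ₑ) y ^ β := by
        rw [ENNReal.mul_rpow_of_nonneg _ _ h1β, ENNReal.mul_rpow_of_nonneg _ _ h1β]
        ring
    _ ≤ V * ENNReal.ofReal C * 2 ^ (1 - β) * a ^ (1 - β) *
          hlMax volume (fun z => ‖f z‖ₑ) y ^ β := by gcongr
    _ = _ := by
        rw [ENNReal.coe_mul, ENNReal.coe_mul, ENNReal.coe_mul,
          ENNReal.coe_rpow_of_nonneg _ h1β, ENNReal.coe_rpow_of_nonneg _ h1β]
        rfl

end OrliczMorrey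

/-! ### Sufficiency. -/

namespace OrliczMorrey

variable {n : ℕ} {Φ Ψ : ℝ≥0 → ℝ≥0∞} {α β : ℝ} {φ η : ℝ → ℝ}

theorem measurable_fracMax (α : ℝ) (f : EuclideanSpace ℝ (Fin n) → ℝ) :
    Measurable (fracMax α f) := by
  refine LowerSemicontinuous.measurable ?_
  refine lowerSemicontinuous_iSup fun t => lowerSemicontinuous_iSup fun ht => ?_
  simp_rw [Measure.addHaar_ball_center volume _ t]
  have hne : volume (Metric.ball (0 : EuclideanSpace ℝ (Fin n)) t) ^ (-1 + α / n) ≠ ∞ :=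
    ENNReal.rpow_ne_top_of_ne_zero (volume_ball_pos _ ht).ne' (volume_ball_lt_top _ _).ne
  exact (ENNReal.continuous_const_mul hne).comp_lowerSemicontinuous
    (lowerSemicontinuous_setLIntegral_ball volume _ t) (fun _ _ h => mul_le_mul_right h _)

theorem MemOrliczLoc.setLIntegral_enorm_lt_top {f : EuclideanSpace ℝ (Fin n) → ℝ}
    (hf : MemOrliczLoc Φ f) (x : EuclideanSpace ℝ (Fin n)) {r : ℝ} (hr : 0 < r) :
    ∫⁻ y, (Metric.ball x r).indicator (fun z => ‖f z‖ₑ) y < ∞ := by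
  have h1 := ((hf x r hr).1.integrableOn_isCompact (isCompact_closedBall x r)).2
  rw [hasFiniteIntegral_iff_enorm] at h1
  refine lt_of_le_of_lt ?_ h1
  rw [← lintegral_indicator measurableSet_closedBall]
  refine lintegral_mono fun y => ?_
  by_cases hy : y ∈ Metric.ball x r
  · rw [indicator_of_mem hy, indicator_of_mem (Metric.ball_subset_closedBall hy),
      indicator_of_mem hy]
  · rw [indicator_of_notMem hy]
    exact zero_le

/-- Since `f` is only locally integrable, Kolmogorov is applied to its restriction to `B(x,2r)`; the
far part is bounded on `B(x,r)`. -/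
theorem IsYoung.setLIntegral_hlMax_rpow_lt_top [Nontrivial (EuclideanSpace ℝ (Fin n))]
    (h : IsYoung Φ) {f : EuclideanSpace ℝ (Fin n) → ℝ} (hf : MemOrliczLoc Φ f)
    {x : EuclideanSpace ℝ (Fin n)} {r : ℝ} (hr : 0 < r) {b : ℝ≥0}
    (hb : ∀ t, r < t → ballInv Φ x t * orliczNorm Φ ((Metric.ball x t).indicator f) ≤ b)
    (hβ : 0 < β) (hβ1 : β < 1) :
    ∫⁻ y in Metric.ball x r, hlMax volume (fun z => ‖f z‖ₑ) y ^ β < ∞ := by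
  have hle : ∀ y ∈ Metric.ball x r, hlMax volume (fun z => ‖f z‖ₑ) y ^ β ≤
      hlMax volume ((Metric.ball x (2 * r)).indicator fun z => ‖f z‖ₑ) y ^ β +
        (2 ^ n * (2 * b)) ^ β := by
    intro y hy
    have := hlMax_le_max (g := fun z => ‖f z‖ₑ) hy (K := 2 * b) fun t ht =>
      (h.average_le f x (hr.trans ht)).trans (mul_le_mul_right (hb t ht) _)
    rcases le_max_iff.1 this with h1 | h1
    · exact le_add_of_le_left (by gcongr)
    · exact le_add_of_le_right (by gcongr)
  refine (setLIntegral_mono' measurableSet_ball hle).trans_lt ?_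
  rw [lintegral_add_right _ measurable_const, setLIntegral_const]
  refine ENNReal.add_lt_top.2 ⟨OrliczMorrey.setLIntegral_hlMax_rpow_lt_top _
    (hf.setLIntegral_enorm_lt_top x (by positivity)) (volume_ball_lt_top _ _) hβ hβ1, ?_⟩
  exact ENNReal.mul_lt_top (ENNReal.rpow_lt_top_of_nonneg hβ.le (by finiteness))
    (volume_ball_lt_top _ _)

theorem IsYoung.fracMaxWeakBounded_of_maxCondition [Nontrivial (EuclideanSpace ℝ (Fin n))]
    (h : IsYoung Φ) (hβ : 0 < β) (hβ1 : β < 1) (hφ : ∀ t, 0 < t → 0 < φ t)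
    (hη : ∀ t, 0 < t → η t = φ t ^ β) (hΨ : ∀ t, Ψ t = Φ (t ^ (1 / β)))
    (hM : MaxCondition Φ (fun (_ : EuclideanSpace ℝ (Fin n)) r => φ r))
    (hP : PowerCondition α β φ) :
    FracMaxWeakBounded α Φ (fun (_ : EuclideanSpace ℝ (Fin n)) r => φ r) Ψ (fun _ r => η r) := by
  obtain ⟨c, hc, hHed⟩ := exists_fracMax_le_mul_rpow_hlMax (n := n) hβ hβ1 hφ hP h
  obtain ⟨D, hD⟩ := hM
  set L : ℝ≥0 := 4 * 10 ^ n * (D + 1) with hL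
  -- `D + 1` instead of `D` keeps the bound positive, as the ball estimate requires.
  have key : ∀ (f : EuclideanSpace ℝ (Fin n) → ℝ) (a : ℝ≥0), 0 < a →
      morreyNorm Φ (fun _ r => φ r) f ≤ a → ∀ (x : EuclideanSpace ℝ (Fin n)) (r : ℝ), 0 < r →
      ∀ t, r < t → ballInv Φ x t * orliczNorm Φ ((Metric.ball x t).indicator f) ≤
        (((D + 1) * (φ r).toNNReal * a : ℝ≥0) : ℝ≥0∞) := by
    intro f a ha hfa x r hr t ht
    refine (h.ballInv_mul_orliczNorm_le_of_lt (φ := fun _ r => φ r) hφ (hD x r hr) ha hfa hr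
      ht).trans ?_
    push_cast
    gcongr
    · exact le_self_add
    · rfl
  have hnorm : ∀ (f : EuclideanSpace ℝ (Fin n) → ℝ) (a : ℝ≥0), 0 < a →
      morreyNorm Φ (fun _ r => φ r) f ≤ a → ∀ (x : EuclideanSpace ℝ (Fin n)) (r : ℝ), 0 < r →
      weakOrliczNorm Ψ ((Metric.ball x r).indicator (fracMax α f)) ≤
        ((c * a ^ (1 - β) * (L * a * (φ r).toNNReal / (ballInv Φ x r).toNNReal) ^ β : ℝ≥0) :
          ℝ≥0∞) := by
    intro f a ha hfa x r hr
    have hp : ballInv Φ x r = (ballInv Φ x r).toNNReal :=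
      (ENNReal.coe_toNNReal (h.ballInv_lt_top x hr).ne).symm
    have hp0 : 0 < (ballInv Φ x r).toNNReal :=
      ENNReal.toNNReal_pos (h.ballInv_pos x r).ne' (h.ballInv_lt_top x hr).ne
    have hq : 0 < (φ r).toNNReal := Real.toNNReal_pos.2 (hφ r hr)
    refine weakOrliczNorm_le_mul_rpow hβ hΨ (H := (Metric.ball x r).indicator
      (hlMax volume fun z => ‖f z‖ₑ)) (mul_pos hc (NNReal.rpow_pos ha)) (by positivity) ?_ ?_
    · intro y
      by_cases hy : y ∈ Metric.ball x r
      · rw [indicator_of_mem hy, indicator_of_mem hy]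
        exact hHed f a hfa y
      · rw [indicator_of_notMem hy]
        exact zero_le
    · intro τ
      have := h.mul_measure_indicator_hlMax_le_one hp (by positivity) hr
        (key f a ha hfa x r hr) τ
      rwa [show 4 * 10 ^ n * ((D + 1) * (φ r).toNNReal * a) / (ballInv Φ x r).toNNReal =
        L * a * (φ r).toNNReal / (ballInv Φ x r).toNNReal by rw [hL]; ring] at this
  -- The weights `η(r) = φ(r)^β` and `Ψ⁻¹ = (Φ⁻¹)^β` cancel exactly, and `a^(1-β) a^β = a`.
  have hMorrey : ∀ (f : EuclideanSpace ℝ (Fin n) → ℝ) (a : ℝ≥0), 0 < a →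
      morreyNorm Φ (fun _ r => φ r) f ≤ a →
      weakMorreyNorm Ψ (fun _ r => η r) (fracMax α f) ≤ ((c * L ^ β : ℝ≥0) : ℝ≥0∞) * a := by
    intro f a ha hfa
    refine iSup_le fun x => iSup₂_le fun r hr => ?_
    refine (mul_le_mul_right (hnorm f a ha hfa x r hr) _).trans (le_of_eq ?_)
    have hp0 : 0 < (ballInv Φ x r).toNNReal :=
      ENNReal.toNNReal_pos (h.ballInv_pos x r).ne' (h.ballInv_lt_top x hr).ne
    have hq : 0 < (φ r).toNNReal := Real.toNNReal_pos.2 (hφ r hr)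
    have hΨp : ballInv Ψ x r = (((ballInv Φ x r).toNNReal ^ β : ℝ≥0) : ℝ≥0∞) := by
      rw [ENNReal.coe_rpow_of_nonneg _ hβ.le, ENNReal.coe_toNNReal (h.ballInv_lt_top x hr).ne]
      exact youngInv_rpow hβ hΨ _
    have hηq : ENNReal.ofReal (η r) = (((φ r).toNNReal ^ β : ℝ≥0) : ℝ≥0∞) := by
      rw [hη r hr, ENNReal.coe_rpow_of_nonneg _ hβ.le, ← ENNReal.ofReal_rpow_of_pos (hφ r hr)]
      rfl
    have hqβ := NNReal.rpow_pos (p := β) hq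
    have hpβ := NNReal.rpow_pos (p := β) hp0
    have haβ := NNReal.rpow_pos (p := β) ha
    rw [hΨp, hηq, ← ENNReal.coe_inv hqβ.ne', ← ENNReal.coe_mul, ← ENNReal.coe_mul,
      ← ENNReal.coe_mul]
    congr 1
    rw [NNReal.div_rpow, NNReal.mul_rpow, NNReal.mul_rpow, NNReal.rpow_sub ha.ne', NNReal.rpow_one]
    field_simp
  refine ⟨c * L ^ β, fun f hf => ?_⟩
  have hle : weakMorreyNorm Ψ (fun _ r => η r) (fracMax α f) ≤
      ((c * L ^ β : ℝ≥0) : ℝ≥0∞) * morreyNorm Φ (fun _ r => φ r) f := by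
    -- The Morrey norm may vanish, so the positive bound `m + ε / (K + 1)` is used, at a cost of at
    -- most `ε`.
    refine ENNReal.le_of_forall_pos_le_add fun ε hε _ => ?_
    set K := c * L ^ β with hK
    set m := (morreyNorm Φ (fun _ r => φ r) f).toNNReal with hm
    have hmc : morreyNorm Φ (fun _ r => φ r) f = m := (ENNReal.coe_toNNReal hf.2.ne).symm
    refine (hMorrey f (m + ε / (K + 1)) (by positivity) ?_).trans ?_
    · rw [hmc]
      exact_mod_cast le_self_add
    · rw [hmc]
      norm_cast
      rw [mul_add]
      gcongr
      rw [← mul_div_assoc, div_le_iff₀ (by positivity), mul_comm]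
      gcongr
      exact le_self_add
  refine ⟨⟨fun x r hr => ⟨?_, ?_⟩, hle.trans_lt (ENNReal.mul_lt_top ENNReal.coe_lt_top hf.2)⟩, hle⟩
  · set a := (morreyNorm Φ (fun _ r => φ r) f).toNNReal + 1 with ha
    have ha0 : 0 < a := by positivity
    have hfa : morreyNorm Φ (fun _ r => φ r) f ≤ a := by
      rw [ha, ENNReal.coe_add, ENNReal.coe_toNNReal hf.2.ne]
      exact le_self_add
    have hint : Integrable ((Metric.ball x r).indicator (fracMax α f)) := by
      refine ⟨((measurable_fracMax α f).indicator measurableSet_ball).aestronglyMeasurable, ?_⟩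
      rw [hasFiniteIntegral_iff_enorm]
      simp only [enorm_eq_self]
      rw [lintegral_indicator measurableSet_ball]
      refine (lintegral_mono fun y => hHed f a hfa y).trans_lt ?_
      rw [lintegral_const_mul' _ _ ENNReal.coe_ne_top]
      exact ENNReal.mul_lt_top ENNReal.coe_lt_top (h.setLIntegral_hlMax_rpow_lt_top hf.1 hr
        (key f a ha0 hfa x r hr) hβ hβ1)
    exact hint.locallyIntegrable
  · refine (hnorm f ((morreyNorm Φ (fun _ r => φ r) f).toNNReal + 1) (by positivity) ?_ x r
      hr).trans_lt ENNReal.coe_lt_top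
    rw [ENNReal.coe_add, ENNReal.coe_toNNReal hf.2.ne]
    exact le_self_add

theorem SupCondition.powerCondition (hφ : ∀ t, 0 < t → 0 < φ t) (h : SupCondition α β φ) :
    PowerCondition α β φ := by
  obtain ⟨C, hC⟩ := h
  refine ⟨C + 1, by positivity, fun t ht => ?_⟩
  have hφβ := Real.rpow_pos_of_pos (hφ t ht) β
  have h1 := le_self_add.trans (hC t ht)
  rw [← ENNReal.ofReal_coe_nnreal, ← ENNReal.ofReal_mul C.coe_nonneg,
    ENNReal.ofReal_le_ofReal_iff (mul_nonneg C.coe_nonneg hφβ.le)] at h1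
  linarith

/-- Some `s` in `(t,2t)` has a quotient at least the essential infimum; by doubling `Φ⁻¹` changes by
at most `2 ^ n` between `t` and `s`, which leaves `2 ^ n φ(s)`, controlled by `φ(r)`. -/
theorem IsYoung.maxCondition_of_almostDecreasing [Nontrivial (EuclideanSpace ℝ (Fin n))]
    (h : IsYoung Φ) (hφ : AlmostDecreasing fun t => ENNReal.ofReal (φ t)) :
    MaxCondition Φ (fun (_ : EuclideanSpace ℝ (Fin n)) r => φ r) := by
  obtain ⟨C, hC0, hC⟩ := hφ
  refine ⟨2 ^ n * C⁻¹, fun x r hr => iSup₂_le fun t ht => ?_⟩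
  have ht0 : 0 < t := hr.trans ht
  have hae := ae_restrict_of_ae_restrict_of_subset 
    (show Ioo t (2 * t) ⊆ Ioi t from Ioo_subset_Ioi_self)
    (ae_essInf_le (μ := volume.restrict (Ioi t))
      (f := fun s => ENNReal.ofReal (φ s) / ballInv Φ x s))
  have hne : (ae ((volume : Measure ℝ).restrict (Ioo t (2 * t)))).NeBot := by
    rw [ae_neBot, Ne, Measure.restrict_eq_zero, Real.volume_Ioo, ENNReal.ofReal_eq_zero]
    linarith
  obtain ⟨s, hs, hst⟩ := (hae.and (ae_restrict_mem measurableSet_Ioo)).exists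
  have h1 : ENNReal.ofReal (φ s) ≤ (C : ℝ≥0∞)⁻¹ * ENNReal.ofReal (φ r) := by
    rw [← ENNReal.div_eq_inv_mul, ENNReal.le_div_iff_mul_le (by simp [hC0.ne']) (by simp),
      mul_comm]
    exact hC r s hr (ht.trans hst.1).le
  calc _ ≤ 2 ^ n * ballInv Φ x s * (ENNReal.ofReal (φ s) / ballInv Φ x s) := by
        gcongr
        refine (h.ballInv_le_two_mul x ht0.le).trans ?_
        gcongr
        exact ballInv_anti x hst.2.le
    _ = 2 ^ n * ENNReal.ofReal (φ s) := by
        rw [mul_assoc, ENNReal.mul_div_cancel (h.ballInv_pos x s).ne'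
          (h.ballInv_lt_top x (ht0.trans hst.1)).ne]
    _ ≤ 2 ^ n * ((C : ℝ≥0∞)⁻¹ * ENNReal.ofReal (φ r)) := by gcongr
    _ = _ := by
        rw [ENNReal.coe_mul, ENNReal.coe_inv hC0.ne', mul_assoc]
        simp

end OrliczMorrey

/-! ### Necessity: testing on indicators of balls. -/

namespace OrliczMorrey

variable {n : ℕ} {Φ Ψ : ℝ≥0 → ℝ≥0∞} {α β : ℝ} {φ η : ℝ → ℝ}

theorem IsYoung.orliczNorm_indicator_ball_le (h : IsYoung Φ) (x : EuclideanSpace ℝ (Fin n))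
    {r : ℝ} (hr : 0 < r) :
    orliczNorm Φ ((Metric.ball x r).indicator fun _ => (1 : ℝ)) ≤ 2 / ballInv Φ x r := by
  set p := (ballInv Φ x r).toNNReal with hp
  have hpe : ballInv Φ x r = p := (ENNReal.coe_toNNReal (h.ballInv_lt_top x hr).ne).symm
  have hp0 : 0 < p := ENNReal.toNNReal_pos (h.ballInv_pos x r).ne' (h.ballInv_lt_top x hr).ne
  refine iInf₂_le_of_le (2 / p) (by positivity) (iInf_le_of_le ?_ ?_)
  · have h1 : Φ (1 / (2 / p)) ≤ (volume (Metric.ball x r))⁻¹ := by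
      refine map_le_of_lt_youngInv (lt_of_lt_of_eq ?_ hpe.symm)
      rw [one_div_div, ENNReal.coe_lt_coe]
      exact NNReal.half_lt_self hp0.ne'
    have h2 : ∀ y, Φ (‖(Metric.ball x r).indicator (fun _ => (1 : ℝ)) y‖₊ / (2 / p)) =
        (Metric.ball x r).indicator (fun _ => Φ (1 / (2 / p))) y := by
      intro y
      by_cases hy : y ∈ Metric.ball x r <;> simp [hy, h.zero]
    simp_rw [h2]
    rw [lintegral_indicator_const measurableSet_ball]
    exact (mul_le_mul_left h1 _).trans (ENNReal.inv_mul_le_one _)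
  · rw [hpe, ENNReal.coe_div hp0.ne', ENNReal.coe_ofNat]

theorem IsYoung.memOrliczLoc_indicator_ball (h : IsYoung Φ) (y : EuclideanSpace ℝ (Fin n))
    (s : ℝ) : MemOrliczLoc Φ ((Metric.ball y s).indicator fun _ => (1 : ℝ)) := by
  intro x r _
  refine ⟨((integrable_indicator_iff measurableSet_ball).2 (integrableOn_const
    (volume_ball_lt_top y s).ne)).indicator measurableSet_ball |>.locallyIntegrable, ?_⟩
  obtain ⟨k, hk, hk1⟩ := h.exists_pos_lt zero_lt_one
  refine ⟨k, hk, lt_of_le_of_lt (lintegral_mono (g := (Metric.ball y s).indicator fun _ => 1)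
    fun z => ?_) ?_⟩
  · by_cases hz : z ∈ Metric.ball y s
    · rw [indicator_of_mem hz]
      refine (h.mono ?_).trans hk1.le
      refine mul_le_of_le_one_right' ?_
      refine (norm_indicator_le_norm_self _ z).trans ?_
      rw [indicator_of_mem hz]
      simp
    · by_cases hx : z ∈ Metric.ball x r <;> simp [hz, hx, h.zero]
  · rw [lintegral_indicator_const measurableSet_ball, one_mul]
    exact volume_ball_lt_top y s

/-- `MemG` is phrased with `t⁻ⁿ`, the norms with `|B(x,t)|⁻¹`. The constant `1 + v + v⁻¹` dominates
both ratios and is at least 1, as `youngInv_mul_le` demands. -/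
theorem IsYoung.exists_ballInv_comparable [Nontrivial (EuclideanSpace ℝ (Fin n))]
    (h : IsYoung Φ) : ∃ D : ℝ≥0, ∀ (x : EuclideanSpace ℝ (Fin n)) (t : ℝ), 0 < t →
      ballInv Φ x t ≤ D * youngInv Φ (ENNReal.ofReal t ^ n)⁻¹ ∧
      youngInv Φ (ENNReal.ofReal t ^ n)⁻¹ ≤ D * ballInv Φ x t := by
  set v := volume (Metric.ball (0 : EuclideanSpace ℝ (Fin n)) 1) with hv
  have hv0 : v ≠ 0 := (volume_ball_pos _ one_pos).ne'
  have hvt : v ≠ ∞ := (volume_ball_lt_top _ _).ne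
  have hvi : v⁻¹ ≠ ∞ := ENNReal.inv_ne_top.2 hv0
  refine ⟨1 + v.toNNReal + v⁻¹.toNNReal, fun x t ht => ?_⟩
  have ht0 : ENNReal.ofReal t ^ n ≠ 0 := by simp [ht]
  have hb : (volume (Metric.ball x t))⁻¹ = v⁻¹ * (ENNReal.ofReal t ^ n)⁻¹ := by
    rw [volume_ball_eq x ht.le, ENNReal.mul_inv (Or.inl ht0) (Or.inl (by finiteness)), mul_comm]
  have hD : ((1 + v.toNNReal + v⁻¹.toNNReal : ℝ≥0) : ℝ≥0∞) = 1 + v + v⁻¹ := by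
    rw [ENNReal.coe_add, ENNReal.coe_add, ENNReal.coe_toNNReal hvt, ENNReal.coe_toNNReal hvi,
      ENNReal.coe_one]
  have h1 : (1 : ℝ≥0) ≤ 1 + v.toNNReal + v⁻¹.toNNReal := by
    rw [add_assoc]
    exact le_self_add
  constructor
  · refine (youngInv_mono ?_).trans (h.youngInv_mul_le h1 _)
    rw [hb, hD]
    gcongr
    exact le_add_self
  · refine (youngInv_mono ?_).trans (h.youngInv_mul_le h1 _)
    rw [hb, hD, ← mul_assoc]
    refine le_mul_of_one_le_left' ?_
    calc (1 : ℝ≥0∞) = v * v⁻¹ := (ENNReal.mul_inv_cancel hv0 hvt).symm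
      _ ≤ _ := by
        gcongr
        exact le_add_right le_add_self

theorem IsYoung.exists_morreyNorm_indicator_ball_le [Nontrivial (EuclideanSpace ℝ (Fin n))]
    (h : IsYoung Φ) (hG : MemG n Φ φ) :
    ∃ K : ℝ≥0, ∀ s : ℝ, 0 < s → morreyNorm Φ (fun _ r => φ r)
      ((Metric.ball (0 : EuclideanSpace ℝ (Fin n)) s).indicator fun _ => (1 : ℝ)) ≤
        K / ENNReal.ofReal (φ s) := by
  obtain ⟨D, hD⟩ := h.exists_ballInv_comparable (n := n)
  obtain ⟨A, hA0, hA⟩ := hG.almostDecreasing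
  obtain ⟨B, -, hB⟩ := hG.almostIncreasing
  refine ⟨2 * A⁻¹ + 2 * D * B * D, fun s hs => iSup_le fun x => iSup₂_le fun r hr => ?_⟩
  have hφr : ENNReal.ofReal (φ r) ≠ 0 := by simpa using hG.pos r hr
  have hφs : ENNReal.ofReal (φ s) ≠ 0 := by simpa using hG.pos s hs
  have hr0 := (h.ballInv_pos x r).ne'
  have hrt := (h.ballInv_lt_top x hr).ne
  -- For `r ≤ s` the indicator of `B(x,r)` is the majorant and `φ` almost decreasing concludes. For
  -- `r ≥ s` the majorant is that of `B(0,s)`, and `φ / Φ⁻¹` almost increasing moves `r` to `s`.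
  rcases le_total r s with hrs | hrs
  · have h1 : orliczNorm Φ ((Metric.ball x r).indicator
        ((Metric.ball (0 : EuclideanSpace ℝ (Fin n)) s).indicator fun _ => (1 : ℝ))) ≤
        2 / ballInv Φ x r := by
      refine (orliczNorm_mono h.mono fun y => ?_).trans (h.orliczNorm_indicator_ball_le x hr)
      by_cases hy : y ∈ Metric.ball x r
      · rw [indicator_of_mem hy, indicator_of_mem hy]
        exact norm_indicator_le_norm_self (fun _ => (1 : ℝ)) y
      · simp [hy]
    have h2 : (ENNReal.ofReal (φ r))⁻¹ ≤ (A : ℝ≥0∞)⁻¹ * (ENNReal.ofReal (φ s))⁻¹ := by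
      rw [← ENNReal.mul_inv (by simp) (by simp), ENNReal.inv_le_inv]
      exact hA r s hr hrs
    calc _ ≤ (A : ℝ≥0∞)⁻¹ * (ENNReal.ofReal (φ s))⁻¹ * ballInv Φ x r * (2 / ballInv Φ x r) := by
          gcongr
      _ = 2 * (A : ℝ≥0∞)⁻¹ / ENNReal.ofReal (φ s) := by
          rw [mul_assoc, ENNReal.mul_div_cancel hr0 hrt, ENNReal.div_eq_inv_mul]
          ring
      _ ≤ _ := by
          push_cast
          rw [ENNReal.coe_inv hA0.ne']
          gcongr
          exact le_self_add
  · have hs0 := (h.ballInv_pos (0 : EuclideanSpace ℝ (Fin n)) s).ne'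
    have hst := (h.ballInv_lt_top (0 : EuclideanSpace ℝ (Fin n)) hs).ne
    have h1 : orliczNorm Φ ((Metric.ball x r).indicator
        ((Metric.ball (0 : EuclideanSpace ℝ (Fin n)) s).indicator fun _ => (1 : ℝ))) ≤
        2 / ballInv Φ (0 : EuclideanSpace ℝ (Fin n)) s :=
      (orliczNorm_mono h.mono fun y => norm_indicator_le_norm_self _ y).trans
        (h.orliczNorm_indicator_ball_le _ hs)
    have hY : ∀ t : ℝ, 0 < t → youngInv Φ (ENNReal.ofReal t ^ n)⁻¹ ≠ 0 ∧
        youngInv Φ (ENNReal.ofReal t ^ n)⁻¹ ≠ ∞ := fun t ht =>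
      ⟨(h.youngInv_pos (ENNReal.inv_pos.2 (by finiteness))).ne',
        (h.youngInv_lt_top (ENNReal.inv_lt_top.2 (by
          rw [pos_iff_ne_zero]
          simp [ht]))).ne⟩
    have h2 : (ENNReal.ofReal (φ r))⁻¹ * youngInv Φ (ENNReal.ofReal r ^ n)⁻¹ ≤
        B * ((ENNReal.ofReal (φ s))⁻¹ * youngInv Φ (ENNReal.ofReal s ^ n)⁻¹) := by
      have h3 := hB s r hs hrs
      rw [← ENNReal.inv_le_inv, ENNReal.mul_inv (Or.inr (ENNReal.div_ne_top (by simp)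
        (hY r hr).1)) (Or.inl (by simp)), ENNReal.inv_div (Or.inr (by simp)) (Or.inr hφr),
        ENNReal.inv_div (Or.inr (by simp)) (Or.inr hφs)] at h3
      rw [← ENNReal.div_eq_inv_mul, ← ENNReal.div_eq_inv_mul]
      rw [← ENNReal.div_eq_inv_mul] at h3
      by_cases hB0 : B = 0
      · rw [hB0, ENNReal.coe_zero, ENNReal.div_zero, top_le_iff] at h3
        · exact absurd h3 (ENNReal.div_ne_top (hY s hs).2 hφs)
        · exact ENNReal.div_ne_zero.2 ⟨(hY r hr).1, by simp⟩
      · rw [mul_comm]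
        exact (ENNReal.div_le_iff_le_mul (Or.inl (by simpa using hB0)) (Or.inl (by simp))).1 h3
    calc _ ≤ (ENNReal.ofReal (φ r))⁻¹ * (D * youngInv Φ (ENNReal.ofReal r ^ n)⁻¹) *
            (2 / ballInv Φ (0 : EuclideanSpace ℝ (Fin n)) s) := by
          gcongr
          exact (hD x r hr).1
      _ = D * ((ENNReal.ofReal (φ r))⁻¹ * youngInv Φ (ENNReal.ofReal r ^ n)⁻¹) *
            (2 / ballInv Φ (0 : EuclideanSpace ℝ (Fin n)) s) := by ring
      _ ≤ D * (B * ((ENNReal.ofReal (φ s))⁻¹ *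
            (D * ballInv Φ (0 : EuclideanSpace ℝ (Fin n)) s))) *
            (2 / ballInv Φ (0 : EuclideanSpace ℝ (Fin n)) s) := by
          refine mul_le_mul_left (mul_le_mul_right (h2.trans ?_) _) _
          gcongr
          exact (hD 0 s hs).2
      _ = D * B * D * (ENNReal.ofReal (φ s))⁻¹ * (ballInv Φ (0 : EuclideanSpace ℝ (Fin n)) s *
            (2 / ballInv Φ (0 : EuclideanSpace ℝ (Fin n)) s)) := by ring
      _ = 2 * D * B * D / ENNReal.ofReal (φ s) := by
          rw [ENNReal.mul_div_cancel hs0 hst, ENNReal.div_eq_inv_mul]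
          ring
      _ ≤ _ := by
          push_cast
          gcongr
          exact le_add_self

theorem exists_mul_rpow_le_fracMax_indicator_ball [Nontrivial (EuclideanSpace ℝ (Fin n))]
    (α : ℝ) : ∃ w : ℝ≥0, 0 < w ∧ ∀ s : ℝ, 0 < s →
      ∀ x ∈ Metric.ball (0 : EuclideanSpace ℝ (Fin n)) s, w * ENNReal.ofReal (s ^ α) ≤
        fracMax α ((Metric.ball (0 : EuclideanSpace ℝ (Fin n)) s).indicator fun _ => (1 : ℝ)) x := by
  have hn : (n : ℝ) ≠ 0 := by
    rw [Nat.cast_ne_zero, ← finrank_euclideanSpace_fin (𝕜 := ℝ) (n := n)]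
    exact Module.finrank_pos.ne'
  set v := volume (Metric.ball (0 : EuclideanSpace ℝ (Fin n)) 1) with hv
  have hv0 : v ≠ 0 := (volume_ball_pos _ one_pos).ne'
  have hvt : v ≠ ∞ := (volume_ball_lt_top _ _).ne
  have h20 : (2 : ℝ≥0∞) ^ n ≠ 0 := by simp
  have h2t : (2 : ℝ≥0∞) ^ n ≠ ∞ := by finiteness
  set W := ((2 : ℝ≥0∞) ^ n) ^ (-1 + α / n) * v ^ (α / n) with hW
  have hW0 : W ≠ 0 := by
    simp [hW, ENNReal.rpow_eq_zero_iff, hv0, hvt, h2t]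
  have hWt : W ≠ ∞ := ENNReal.mul_ne_top (ENNReal.rpow_ne_top_of_ne_zero h20 h2t)
    (ENNReal.rpow_ne_top_of_ne_zero hv0 hvt)
  refine ⟨W.toNNReal, ENNReal.toNNReal_pos hW0 hWt, fun s hs x hx => ?_⟩
  rw [ENNReal.coe_toNNReal hWt]
  -- Radius `2s` makes the ball around `x` contain `B(0,s)`; `W` collects the resulting powers of `2
  -- ^ n` and `v`.
  refine le_iSup₂_of_le (2 * s) (by positivity) ?_
  have hsub : Metric.ball (0 : EuclideanSpace ℝ (Fin n)) s ⊆ Metric.ball x (2 * s) := by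
    refine Metric.ball_subset_ball' ?_
    rw [Metric.mem_ball'] at hx
    linarith
  have hb0 := (volume_ball_pos (0 : EuclideanSpace ℝ (Fin n)) hs).ne'
  have hbt := (volume_ball_lt_top (0 : EuclideanSpace ℝ (Fin n)) s).ne
  have hint : volume (Metric.ball (0 : EuclideanSpace ℝ (Fin n)) s) ≤
      ∫⁻ y in Metric.ball x (2 * s),
        ‖(Metric.ball (0 : EuclideanSpace ℝ (Fin n)) s).indicator (fun _ => (1 : ℝ)) y‖ₑ := by
    refine le_trans ?_ (lintegral_mono_set hsub)
    rw [← setLIntegral_one]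
    refine setLIntegral_mono' measurableSet_ball fun y hy => ?_
    rw [indicator_of_mem hy]
    simp
  refine le_trans (le_of_eq ?_) (mul_le_mul_right hint _)
  rw [volume_ball_two_mul x 0 hs.le, ENNReal.mul_rpow_of_ne_top h2t hbt,
    mul_assoc _ (volume (Metric.ball (0 : EuclideanSpace ℝ (Fin n)) s) ^ (-1 + α / n))]
  rw [show volume (Metric.ball (0 : EuclideanSpace ℝ (Fin n)) s) ^ (-1 + α / n) *
      volume (Metric.ball (0 : EuclideanSpace ℝ (Fin n)) s) =
      volume (Metric.ball (0 : EuclideanSpace ℝ (Fin n)) s) ^ (α / n) by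
    rw [ENNReal.rpow_add _ _ hb0 hbt, ENNReal.rpow_neg_one, mul_right_comm,
      ENNReal.inv_mul_cancel hb0 hbt, one_mul]]
  rw [volume_ball_eq 0 hs.le, ENNReal.mul_rpow_of_ne_top (by finiteness) hvt,
    ← ENNReal.rpow_natCast (ENNReal.ofReal s), ← ENNReal.rpow_mul, mul_div_cancel₀ _ hn,
    ENNReal.ofReal_rpow_of_pos hs, hW]
  ring

theorem IsYoung.powerCondition_of_fracMaxWeakBounded [Nontrivial (EuclideanSpace ℝ (Fin n))]
    (h : IsYoung Φ) (hβ : 0 < β) (hη : ∀ t, 0 < t → η t = φ t ^ β)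
    (hΨ : ∀ t, Ψ t = Φ (t ^ (1 / β))) (hG : MemG n Φ φ)
    (hM : FracMaxWeakBounded α Φ (fun (_ : EuclideanSpace ℝ (Fin n)) r => φ r)
      Ψ (fun _ r => η r)) :
    PowerCondition α β φ := by
  obtain ⟨C, hC⟩ := hM
  obtain ⟨K, hK⟩ := h.exists_morreyNorm_indicator_ball_le hG
  obtain ⟨w, hw, hwle⟩ := exists_mul_rpow_le_fracMax_indicator_ball (n := n) α
  have hΨmono : Monotone Ψ := fun a b hab => by
    rw [hΨ, hΨ]
    exact h.mono (by gcongr)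
  refine ⟨2 * C * K / w + 1, by positivity, fun s hs => ?_⟩
  set B := Metric.ball (0 : EuclideanSpace ℝ (Fin n)) s with hB
  set f := B.indicator fun _ => (1 : ℝ) with hf
  have hq : 0 < (φ s).toNNReal := Real.toNNReal_pos.2 (hG.pos s hs)
  set q := (φ s).toNNReal with hqdef
  set T := (s ^ α).toNNReal with hT
  have hT0 : 0 < T := Real.toNNReal_pos.2 (Real.rpow_pos_of_pos hs α)
  have hfm : MemMorrey Φ (fun _ r => φ r) f :=
    ⟨h.memOrliczLoc_indicator_ball 0 s, (hK s hs).trans_lt (ENNReal.div_lt_top (by simp)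
      (by simpa using hG.pos s hs))⟩
  have hI0 : ballInv Ψ (0 : EuclideanSpace ℝ (Fin n)) s ≠ 0 := by
    rw [ballInv, youngInv_rpow hβ hΨ]
    exact (ENNReal.rpow_pos (h.ballInv_pos _ _) (h.ballInv_lt_top _ hs).ne).ne'
  have hIt : ballInv Ψ (0 : EuclideanSpace ℝ (Fin n)) s ≠ ∞ := by
    rw [ballInv, youngInv_rpow hβ hΨ]
    exact ENNReal.rpow_ne_top_of_nonneg hβ.le (h.ballInv_lt_top _ hs).ne
  -- At half the lower bound `w s^α` the superlevel set contains all of `B(0,s)`, so `Ψ(w T / (2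
  -- lam)) ≤ |B|⁻¹` for every admissible `lam`.
  have hlow : ((w * T / 2 : ℝ≥0) : ℝ≥0∞) ≤ ballInv Ψ (0 : EuclideanSpace ℝ (Fin n)) s *
      weakOrliczNorm Ψ (B.indicator (fracMax α f)) := by
    rw [mul_comm (ballInv _ _ _), ← ENNReal.div_le_iff_le_mul (Or.inl hI0) (Or.inl hIt)]
    refine le_iInf₂ fun lam hlam => le_iInf fun hle => ?_
    rw [ENNReal.div_le_iff_le_mul (Or.inl hI0) (Or.inl hIt), mul_comm (lam : ℝ≥0∞),
      ← ENNReal.div_le_iff_le_mul (Or.inl (by simpa using hlam.ne')) (Or.inl (by simp)),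
      ← ENNReal.coe_div hlam.ne']
    refine le_youngInv hΨmono ?_
    have h1 := (le_iSup₂_of_le (f := fun (t : ℝ≥0) (_ : 0 < t) => Ψ (t / lam) *
      distrib (B.indicator (fracMax α f)) t) (w * T / 2) (by positivity) le_rfl).trans hle
    rw [← one_div, ENNReal.le_div_iff_mul_le (Or.inl (volume_ball_pos _ hs).ne')
      (Or.inl (volume_ball_lt_top _ _).ne)]
    refine le_trans (mul_le_mul_right (measure_mono fun y hy => ?_) _) h1
    change (_ : ℝ≥0∞) < B.indicator (fracMax α f) y
    rw [indicator_of_mem hy]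
    refine lt_of_lt_of_le ?_ (hwle s hs y hy)
    change ((w * T / 2 : ℝ≥0) : ℝ≥0∞) < (w : ℝ≥0∞) * (T : ℝ≥0∞)
    rw [← ENNReal.coe_mul, ENNReal.coe_lt_coe]
    exact NNReal.half_lt_self (by positivity)
  have hup : (ENNReal.ofReal (η s))⁻¹ * (ballInv Ψ (0 : EuclideanSpace ℝ (Fin n)) s *
      weakOrliczNorm Ψ (B.indicator (fracMax α f))) ≤ C * (K / ENNReal.ofReal (φ s)) := by
    rw [← mul_assoc]
    refine le_trans ?_ ((hC f hfm).2.trans (mul_le_mul_right (hK s hs) _))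
    exact le_iSup_of_le 0 (le_iSup₂_of_le s hs le_rfl)
  have hηq : ENNReal.ofReal (η s) = ((q ^ β : ℝ≥0) : ℝ≥0∞) := by
    rw [hη s hs, ENNReal.coe_rpow_of_nonneg _ hβ.le, ← ENNReal.ofReal_rpow_of_pos (hG.pos s hs)]
    rfl
  have hqβ : 0 < q ^ β := NNReal.rpow_pos hq
  have hall := (mul_le_mul_right hlow _).trans hup
  rw [hηq, show ENNReal.ofReal (φ s) = (q : ℝ≥0∞) from rfl, ← ENNReal.coe_inv hqβ.ne',
    ← ENNReal.coe_div hq.ne', ← ENNReal.coe_mul, ← ENNReal.coe_mul, ENNReal.coe_le_coe] at hall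
  have hreal : (q ^ β : ℝ)⁻¹ * (w * T / 2) ≤ C * (K / q) := by exact_mod_cast hall
  have hqr : (q : ℝ) = φ s := Real.coe_toNNReal _ (hG.pos s hs).le
  have hTr : (T : ℝ) = s ^ α := Real.coe_toNNReal _ (Real.rpow_pos_of_pos hs α).le
  rw [hqr, hTr] at hreal
  have hφs := hG.pos s hs
  have hφβ := Real.rpow_pos_of_pos hφs β
  have hwr : (0 : ℝ) < w := hw
  rw [inv_mul_le_iff₀ hφβ, ← mul_div_assoc, ← mul_div_assoc, le_div_iff₀ hφs] at hreal
  have h2 : s ^ α * φ s ≤ 2 * C * K / w * φ s ^ β := by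
    rw [div_mul_eq_mul_div, le_div_iff₀ hwr]
    linarith
  linarith

end OrliczMorrey

theorem mainTheorem2 (n : ℕ) (α β : ℝ) (hα : 0 < α) (hαn : α < n) (hβ : 0 < β) (hβ1 : β < 1)
    (Φ Ψ : ℝ≥0 → ℝ≥0∞) (hΦ : OrliczMorrey.IsYoung Φ) (hΔ : OrliczMorrey.DeltaPrime Φ)
    (φ η : ℝ → ℝ)
    (hφ : OrliczMorrey.MemOmega Φ (fun (_ : EuclideanSpace ℝ (Fin n)) r => φ r))
    (hη : ∀ t, 0 < t → η t = φ t ^ β) (hΨ : ∀ t, Ψ t = Φ (t ^ (1 / β))) :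
    (OrliczMorrey.MaxCondition Φ (fun (_ : EuclideanSpace ℝ (Fin n)) r => φ r) →
      OrliczMorrey.SupCondition α β φ →
      OrliczMorrey.FracMaxWeakBounded α Φ (fun (_ : EuclideanSpace ℝ (Fin n)) r => φ r)
        Ψ (fun _ r => η r)) ∧
    (OrliczMorrey.MemG n Φ φ →
      OrliczMorrey.FracMaxWeakBounded α Φ (fun (_ : EuclideanSpace ℝ (Fin n)) r => φ r)
        Ψ (fun _ r => η r) →
      OrliczMorrey.PowerCondition α β φ) ∧
    (OrliczMorrey.MemG n Φ φ →
      (OrliczMorrey.PowerCondition α β φ ↔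
        OrliczMorrey.FracMaxWeakBounded α Φ (fun (_ : EuclideanSpace ℝ (Fin n)) r => φ r)
          Ψ (fun _ r => η r))) := by
  -- `0 < α < n` excludes dimension zero, so the space is nontrivial, as the covering argument
  -- requires.
  have hn : n ≠ 0 := by
    rintro rfl
    simp only [Nat.cast_zero] at hαn
    linarith
  have : Nontrivial (EuclideanSpace ℝ (Fin n)) := by
    refine Module.nontrivial_of_finrank_pos (R := ℝ) ?_
    rw [finrank_euclideanSpace_fin]
    exact Nat.pos_of_ne_zero hn
  have hφ0 : ∀ t, 0 < t → 0 < φ t := fun t ht => hφ.pos 0 t ht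
  refine ⟨fun hM hS => hΦ.fracMaxWeakBounded_of_maxCondition hβ hβ1 hφ0 hη hΨ hM
      (hS.powerCondition hφ0),
    fun hG hB => hΦ.powerCondition_of_fracMaxWeakBounded hβ hη hΨ hG hB,
    fun hG => ⟨fun hP => hΦ.fracMaxWeakBounded_of_maxCondition hβ hβ1 hφ0 hη hΨ
      (hΦ.maxCondition_of_almostDecreasing hG.almostDecreasing) hP,
    fun hB => hΦ.powerCondition_of_fracMaxWeakBounded hβ hη hΨ hG hB⟩⟩
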